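/- Logic and structures. A vocabulary is a set of relation names, each taking a fixed number of element arguments and a fixed number of set arguments. A structure consists of a finite nonempty universe and an interpretation of each relation name as a relation on elements and subsets of the universe. A class of structures is an isomorphism-invariant class of structures over one vocabulary. MSO is monadic second-order logic with the additional set predicates "$|X|$ is divisible by $p$" for all $p\ge 2$. Transductions. An MSO transduction is a binary relation between structures, taken up to isomorphism of the output, that is a composition of finitely many of the following operations: (i) an MSO interpretation (the new universe, required to be nonempty, is defined by a formula $\varphi(x)$, and each output relation by a formula of the same type); (ii) filtering by an MSO sentence; (iii) $k$-copying, $k\ge 2$ (take $k$ disjoint copies and add the $k$-ary relation of the tuples consisting of the $1$st, …, $k$-th copy of one element); (iv) $k$-colouring, $k\ge 1$ (add $k$ unary relations so that each element satisfies exactly one of them, nondeterministically). For classes $\mathcal C,\mathcal D$, a $\mathcal C$-to-$\mathcal D$ MSO transduction is an MSO transduction between their vocabularies all of whose outputs on inputs from $\mathcal C$ are in $\mathcal D$. An MSO encoding of $\mathcal C$ into $\mathcal D$ is a $\mathcal C$-to-$\mathcal D$ MSO transduction $f$ for which there is a $\mathcal D$-to-$\mathcal C$ MSO transduction $g$ such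 that $f$ followed by $g$ is the identity on $\mathcal C$ (up to isomorphism). Two classes are equivalent under MSO encodings if each admits an MSO encoding into the other. Matroids. Let $F$ be a finite field and $n=|F|-1$. A matroid represented over $F$ is a finite nonempty set $E$ of elements with a function $v$ from $E$ to some vector space over $F$. Its independence representation is the structure with universe $E$ and the relation $\mathrm{independent}(X)$, which holds if the family $(v(x))_{x\in X}$ is linearly independent. Given coefficients $c_1,\dots,c_n\in F$, its null representation is the structure with universe $E$ and the relation on $n$-tuples of subsets of $E$ given by $$c_1\sum_{x\in X_1}v(x)+\cdots+c_n\sum_{x\in X_n}v(x)=0 .$$ Let $\mathcal N$ be the class of all structures isomorphic to the null representation of some matroid represented over $F$. Theorem. Let $F$ be a finite field, and let either $c_1=\cdots=c_n=1$, or let $c_1,\dots,c_n$ be any enumeration of the nonzero elements of $F$. Then the class $\mathcal N$ of matroids over $F$ under null representation is equivalent under MSO encodings to the class of binary relations (all structures over a vocabulary with one binary relation name), and it admits an MSO encoding into the class of matroids over $F$ under independence representation. -/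

import Mathlib

namespace MSO

/-! ### Vocabularies, structures, classes of structures -/

/-- A vocabulary: a set of relation names, each with a number of element arguments and a number of
set arguments. (The element arguments are listed before the set arguments.) -/
structure Vocabulary where
  Rel : Type
  elemArity : Rel → ℕ
  setArity : Rel → ℕ

/-- A structure over a vocabulary: a finite nonempty universe and, for each relation name,
a relation of the corresponding type on elements and subsets of the universe. -/
structure Str (σ : Vocabulary) where
  U : Type
  finite : Finite U
  nonempty : Nonempty U
  rel : ∀ R : σ.Rel, (Fin (σ.elemArity R) → U) → (Fin (σ.setArity R) → Set U) → Prop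

attribute [instance] Str.finite Str.nonempty

/-- Isomorphisms of structures. -/
structure Str.Iso {σ : Vocabulary} (A B : Str σ) where
  toEquiv : A.U ≃ B.U
  map_rel : ∀ (R : σ.Rel) (e : Fin (σ.elemArity R) → A.U) (s : Fin (σ.setArity R) → Set A.U),
    A.rel R e s ↔ B.rel R (fun i => toEquiv (e i)) (fun j => toEquiv '' s j)

/-- `A` and `B` are isomorphic. -/
def Str.IsIso {σ : Vocabulary} (A B : Str σ) : Prop := Nonempty (A.Iso B)

theorem Str.IsIso.refl {σ : Vocabulary} (A : Str σ) : A.IsIso A :=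
  ⟨⟨Equiv.refl _, fun R e s => by simp⟩⟩

theorem Str.IsIso.symm {σ : Vocabulary} {A B : Str σ} (h : A.IsIso B) : B.IsIso A := by
  obtain ⟨f⟩ := h
  refine ⟨⟨f.toEquiv.symm, fun R e s => ?_⟩⟩
  rw [f.map_rel]
  simp

theorem Str.IsIso.trans {σ : Vocabulary} {A B C : Str σ} (h : A.IsIso B) (h' : B.IsIso C) :
    A.IsIso C := by
  obtain ⟨f⟩ := h
  obtain ⟨g⟩ := h'
  refine ⟨⟨f.toEquiv.trans g.toEquiv, fun R e s => ?_⟩⟩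
  rw [f.map_rel, g.map_rel]
  simp [Set.image_image]

/-- A class of structures: an isomorphism-invariant class of structures over a common
vocabulary. -/
structure StrClass (σ : Vocabulary) where
  carrier : Set (Str σ)
  iso_closed : ∀ A B : Str σ, A.IsIso B → A ∈ carrier → B ∈ carrier

/-! ### Counting monadic second-order logic -/

/-- `Formula σ n m` is the type of formulas of monadic second-order logic with modulo counting
over the vocabulary `σ`, with free element variables indexed by `Fin n` and free set variables
indexed by `Fin m`. A quantifier binds the variable with index `0` of its sort. -/
inductive Formula (σ : Vocabulary) : ℕ → ℕ → Type
  | eq {n m : ℕ} (x y : Fin n) : Formula σ n m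
  | mem {n m : ℕ} (x : Fin n) (X : Fin m) : Formula σ n m
  | rel {n m : ℕ} (R : σ.Rel) (x : Fin (σ.elemArity R) → Fin n)
      (X : Fin (σ.setArity R) → Fin m) : Formula σ n m
  | dvdCard {n m : ℕ} (p : ℕ) (hp : 2 ≤ p) (X : Fin m) : Formula σ n m
  | not {n m : ℕ} (φ : Formula σ n m) : Formula σ n m
  | and {n m : ℕ} (φ ψ : Formula σ n m) : Formula σ n m
  | exElem {n m : ℕ} (φ : Formula σ (n + 1) m) : Formula σ n m
  | exSet {n m : ℕ} (φ : Formula σ n (m + 1)) : Formula σ n m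

/-- Satisfaction of a formula in a structure, under a valuation of the element variables and of
the set variables. -/
def Formula.Sat {σ : Vocabulary} (A : Str σ) : {n m : ℕ} → Formula σ n m →
    (Fin n → A.U) → (Fin m → Set A.U) → Prop
  | _, _, .eq x y, e, _ => e x = e y
  | _, _, .mem x X, e, s => e x ∈ s X
  | _, _, .rel R x X, e, s => A.rel R (fun i => e (x i)) (fun j => s (X j))
  | _, _, .dvdCard p _ X, _, s => p ∣ (s X).ncard
  | _, _, .not φ, e, s => ¬ φ.Sat A e s
  | _, _, .and φ ψ, e, s => φ.Sat A e s ∧ ψ.Sat A e s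
  | n, _, .exElem φ, e, s => ∃ a : A.U, φ.Sat A (Fin.cons a e : Fin (n + 1) → A.U) s
  | _, m, .exSet φ, e, s => ∃ S : Set A.U, φ.Sat A e (Fin.cons S s : Fin (m + 1) → Set A.U)

/-! ### MSO transductions -/

/-- An MSO interpretation: a universe formula `φ(x)` and, for every relation name of the output
vocabulary, a relation formula of the same type. -/
structure Interpretation (σ τ : Vocabulary) where
  univ : Formula σ 1 0
  rel : ∀ R : τ.Rel, Formula σ (τ.elemArity R) (τ.setArity R)

/-- The elements of `A` selected by the universe formula. -/
def Interpretation.Universe {σ τ : Vocabulary} (I : Interpretation σ τ) (A : Str σ) : Type :=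
  {a : A.U // I.univ.Sat A (fun _ => a) Fin.elim0}

/-- The output of an interpretation, defined when the new universe is nonempty. A relation formula
only matters on arguments inside the new universe, so that it may be assumed to select only
these. -/
def Interpretation.apply {σ τ : Vocabulary} (I : Interpretation σ τ) (A : Str σ)
    (h : Nonempty (I.Universe A)) : Str τ where
  U := I.Universe A
  finite := Subtype.finite
  nonempty := h
  rel R e s := (I.rel R).Sat A (fun i => (e i).1) (fun j => Subtype.val '' s j)

/-- The vocabulary `σ` with one new relation name, which has `k` element arguments. -/
def Vocabulary.addRel (σ : Vocabulary) (k : ℕ) : Vocabulary where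
  Rel := σ.Rel ⊕ Unit
  elemArity := Sum.elim σ.elemArity fun _ => k
  setArity := Sum.elim σ.setArity fun _ => 0

/-- The vocabulary `σ` with `k` new unary relation names. -/
def Vocabulary.addColours (σ : Vocabulary) (k : ℕ) : Vocabulary where
  Rel := σ.Rel ⊕ Fin k
  elemArity := Sum.elim σ.elemArity fun _ => 1
  setArity := Sum.elim σ.setArity fun _ => 0

/-- `k` disjoint copies of `A`, with the new `k`-ary relation that selects the tuples
`(a₁, …, aₖ)` of all copies, in this order, of an element of `A`. -/
def Str.copies {σ : Vocabulary} (A : Str σ) (k : ℕ) (hk : 2 ≤ k) : Str (σ.addRel k) where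
  U := Fin k × A.U
  finite := inferInstance
  nonempty := ⟨(⟨0, by omega⟩, Classical.choice A.nonempty)⟩
  rel
    | .inl R, e, s => ∃ (c : Fin k) (e' : Fin (σ.elemArity R) → A.U)
        (s' : Fin (σ.setArity R) → Set A.U), A.rel R e' s' ∧
          e = (fun i => (c, e' i)) ∧ s = fun j => Prod.mk c '' s' j
    | .inr _, e, _ => ∃ a : A.U, e = fun i : Fin k => (i, a)

/-- `A` with `k` new unary relations, given by a colouring of its elements by `k` colours. -/
def Str.colour {σ : Vocabulary} (A : Str σ) {k : ℕ} (c : A.U → Fin k) :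
    Str (σ.addColours k) where
  U := A.U
  finite := A.finite
  nonempty := A.nonempty
  rel
    | .inl R, e, s => A.rel R e s
    | .inr i, e, _ => c (e (0 : Fin 1)) = i

/-- The MSO transductions: the binary relations between structures that are compositions of
finitely many interpretations, filterings, copyings and colourings. All of these are closed under
isomorphism of the output. The composition of no steps is the identity, i.e. isomorphism. -/
inductive IsMSOTransduction : {σ τ : Vocabulary} → (Str σ → Str τ → Prop) → Prop
  | identity {σ : Vocabulary} : IsMSOTransduction fun A B : Str σ => A.IsIso B
  | interpretation {σ τ : Vocabulary} (I : Interpretation σ τ) :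
      IsMSOTransduction fun (A : Str σ) (B : Str τ) =>
        ∃ h : Nonempty (I.Universe A), (I.apply A h).IsIso B
  | filtering {σ : Vocabulary} (φ : Formula σ 0 0) :
      IsMSOTransduction fun A B : Str σ => φ.Sat A Fin.elim0 Fin.elim0 ∧ A.IsIso B
  | copying {σ : Vocabulary} (k : ℕ) (hk : 2 ≤ k) :
      IsMSOTransduction fun (A : Str σ) (B : Str (σ.addRel k)) => (A.copies k hk).IsIso B
  | colouring {σ : Vocabulary} (k : ℕ) (hk : 1 ≤ k) :
      IsMSOTransduction fun (A : Str σ) (B : Str (σ.addColours k)) =>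
        ∃ c : A.U → Fin k, (A.colour c).IsIso B
  | comp {σ τ υ : Vocabulary} {f : Str σ → Str τ → Prop} {g : Str τ → Str υ → Prop}
      (hf : IsMSOTransduction f) (hg : IsMSOTransduction g) :
      IsMSOTransduction fun A C => ∃ B, f A B ∧ g B C

/-- `f` is a `C`-to-`D` MSO transduction: an MSO transduction such that on inputs from `C` all
outputs are from `D`. -/
def IsMSOTransductionBetween {σ τ : Vocabulary} (C : StrClass σ) (D : StrClass τ)
    (f : Str σ → Str τ → Prop) : Prop :=
  IsMSOTransduction f ∧ ∀ A ∈ C.carrier, ∀ B, f A B → B ∈ D.carrier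

/-- There is an MSO encoding of `C` into `D`: a `C`-to-`D` MSO transduction `f` with a decoding,
i.e. a `D`-to-`C` MSO transduction `g` such that `f` followed by `g` is the identity on `C`. -/
def Encodes {σ τ : Vocabulary} (C : StrClass σ) (D : StrClass τ) : Prop :=
  ∃ (f : Str σ → Str τ → Prop) (g : Str τ → Str σ → Prop),
    IsMSOTransductionBetween C D f ∧ IsMSOTransductionBetween D C g ∧
      ∀ A ∈ C.carrier, ∀ A', (∃ B, f A B ∧ g B A') ↔ A.IsIso A'

/-- Equivalence under MSO encodings. -/
def EncodingEquivalent {σ τ : Vocabulary} (C : StrClass σ) (D : StrClass τ) : Prop :=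
  Encodes C D ∧ Encodes D C

/-! ### Binary relations and represented matroids -/

/-- One relation name, with two element arguments. -/
def binaryVocabulary : Vocabulary where
  Rel := Unit
  elemArity _ := 2
  setArity _ := 0

/-- The class of binary relations: all structures over a vocabulary with one binary relation. -/
def binaryRelations : StrClass binaryVocabulary where
  carrier := Set.univ
  iso_closed _ _ _ _ := trivial

/-- One relation name, with `n` set arguments. -/
def setVocabulary (n : ℕ) : Vocabulary where
  Rel := Unit
  elemArity _ := 0
  setArity _ := n

/-- A matroid represented over the field `F`: a finite nonempty set of elements and a function from
the elements to some vector space over `F`. -/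
structure RepMatroid.{u} (F : Type u) [Field F] where
  E : Type
  finite : Finite E
  nonempty : Nonempty E
  V : Type u
  addCommGroup : AddCommGroup V
  module : Module F V
  vec : E → V

attribute [instance] RepMatroid.addCommGroup RepMatroid.module

/-- The independence representation of a represented matroid: the relation `independent(X)`. -/
def RepMatroid.independenceStr {F : Type*} [Field F] (M : RepMatroid F) : Str (setVocabulary 1) where
  U := M.E
  finite := M.finite
  nonempty := M.nonempty
  rel _ _ X := LinearIndepOn F M.vec (X (0 : Fin 1))

/-- The null representation of a represented matroid, with coefficients `c`: the relation on
sets `X₁, …, Xₙ`, with `n = |F| - 1`, which says that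
`c₁ • (sum of vectors representing X₁) + ⋯ + cₙ • (sum of vectors representing Xₙ) = 0`. -/
noncomputable def RepMatroid.nullStr {F : Type*} [Field F] (M : RepMatroid F)
    (c : Fin (Nat.card F - 1) → F) : Str (setVocabulary (Nat.card F - 1)) where
  U := M.E
  finite := M.finite
  nonempty := M.nonempty
  rel _ _ X := ∑ i : Fin (Nat.card F - 1), c i • ∑ᶠ x ∈ X i, M.vec x = 0

/-- The class of matroids over `F` under independence representation. -/
def independenceMatroids (F : Type*) [Field F] : StrClass (setVocabulary 1) where
  carrier := {A | ∃ M : RepMatroid F, M.independenceStr.IsIso A}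
  iso_closed _ _ h := fun ⟨M, hM⟩ => ⟨M, hM.trans h⟩

/-- The class of matroids over `F` under null representation, with coefficients `c`. -/
def nullMatroids (F : Type*) [Field F] (c : Fin (Nat.card F - 1) → F) :
    StrClass (setVocabulary (Nat.card F - 1)) where
  carrier := {A | ∃ M : RepMatroid F, (M.nullStr c).IsIso A}
  iso_closed _ _ h := fun ⟨M, hM⟩ => ⟨M, hM.trans h⟩

end MSO

/-! Let `k` be the field over which the null relation is really linear: `F` itself when the
coefficients enumerate its nonzero elements, the prime field when they are all 1. In both cases
every element of `k` is a sum of some of the coefficients (the hypothesis `hc` throughout). Hence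
tuples of sets represent all functions from the universe to `k` (`exists_coef_eq`), and MSO can
quantify over linear combinations and tell which ones vanish.

From null structures to binary relations: a colouring guesses a set of elements and a filter keeps
it only if it is a base. The coordinates of all elements over this base form a matrix over `k`,
stored as |k| binary relations. A combination of the vectors vanishes iff the same combination of
coordinate rows does (`nul_iff_coords`). The latter is definable, since a sum in a finite group
depends only on the sizes of the fibres modulo a fixed number (`DefinableFun.finsum`). So the null
structure is recovered, whichever base was guessed (`encodes_binaries`). A gadget on |k| + 1 copies
of the universe merges the relations into one (`encodes_gadget`).

From a binary relation R to matroids: take independent vectors a_u, b_u, c_u for each element u,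
together with a_u + b_u and b_u + c_u + ∑ a_w, summed over all w with R u w. Let a_u occur once, a_u
+ b_u three times and the others twice, so that the sizes of parallel classes separate the a's and
the sums a_u + b_u from the rest. The triangle a_u, b_u, a_u + b_u ties b_u to a_u. The long sum,
b_u, c_u and all the a's are dependent, and they become independent without a_w exactly if R u w
(`decRel_incMatrix_iff`). This decoding uses independence only, and independence is definable from
the null relation; so one construction encodes binary relations into both classes of matroids
(`encodes_null`, `encodes_independenceMatroids`). Composing encodings yields the encoding of null
structures into independence structures. -/

namespace MSO

/-! ### Definable predicates -/

/-- A predicate on structures with element and set parameters is definable if it is defined by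
a formula. -/
def Definable {σ : Vocabulary} {n m : ℕ}
    (P : ∀ A : Str σ, (Fin n → A.U) → (Fin m → Set A.U) → Prop) : Prop :=
  ∃ φ : Formula σ n m, ∀ A e s, φ.Sat A e s ↔ P A e s

/-- Renaming of the free variables of a formula. -/
def Formula.rename {σ : Vocabulary} : {n m n' m' : ℕ} → Formula σ n m → (Fin n → Fin n') →
    (Fin m → Fin m') → Formula σ n' m'
  | _, _, _, _, .eq x y, f, _ => .eq (f x) (f y)
  | _, _, _, _, .mem x X, f, g => .mem (f x) (g X)
  | _, _, _, _, .rel R x X, f, g => .rel R (fun i => f (x i)) (fun j => g (X j))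
  | _, _, _, _, .dvdCard p hp X, _, g => .dvdCard p hp (g X)
  | _, _, _, _, .not φ, f, g => .not (φ.rename f g)
  | _, _, _, _, .and φ ψ, f, g => .and (φ.rename f g) (ψ.rename f g)
  | _, _, _, _, .exElem φ, f, g => .exElem (φ.rename (Fin.cons 0 fun i => (f i).succ) g)
  | _, _, _, _, .exSet φ, f, g => .exSet (φ.rename f (Fin.cons 0 fun i => (g i).succ))

theorem Formula.sat_rename {σ : Vocabulary} (A : Str σ) {n m : ℕ} (φ : Formula σ n m) :
    ∀ {n' m' : ℕ} (f : Fin n → Fin n') (g : Fin m → Fin m') (e : Fin n' → A.U)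
      (s : Fin m' → Set A.U),
      (φ.rename f g).Sat A e s ↔ φ.Sat A (fun i => e (f i)) (fun j => s (g j)) := by
  induction φ with
  | eq x y => intros; rfl
  | mem x X => intros; rfl
  | rel R x X => intros; rfl
  | dvdCard p hp X => intros; rfl
  | not φ ih => intro n' m' f g e s; exact not_congr (ih f g e s)
  | and φ ψ ih ih' => intro n' m' f g e s; exact and_congr (ih f g e s) (ih' f g e s)
  | exElem φ ih =>
    intro n' m' f g e s
    refine exists_congr fun a => ?_
    rw [ih]
    have : (fun i => (Fin.cons a e : Fin _ → A.U) ((Fin.cons 0 fun i => (f i).succ : Fin _ → Fin _) i))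
        = (Fin.cons a (fun i => e (f i)) : Fin _ → A.U) := by
      funext i; refine Fin.cases ?_ (fun i => ?_) i <;> simp
    rw [this]
  | exSet φ ih =>
    intro n' m' f g e s
    refine exists_congr fun a => ?_
    rw [ih]
    have : (fun i => (Fin.cons a s : Fin _ → Set A.U)
        ((Fin.cons 0 fun i => (g i).succ : Fin _ → Fin _) i))
        = (Fin.cons a (fun i => s (g i)) : Fin _ → Set A.U) := by
      funext i; refine Fin.cases ?_ (fun i => ?_) i <;> simp
    rw [this]

namespace Definable

variable {σ : Vocabulary} {n m : ℕ}

theorem congr {P Q : ∀ A : Str σ, (Fin n → A.U) → (Fin m → Set A.U) → Prop}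
    (h : Definable P) (hPQ : ∀ A e s, P A e s ↔ Q A e s) : Definable Q := by
  obtain ⟨φ, hφ⟩ := h
  exact ⟨φ, fun A e s => (hφ A e s).trans (hPQ A e s)⟩

theorem rename {P : ∀ A : Str σ, (Fin n → A.U) → (Fin m → Set A.U) → Prop}
    (h : Definable P) {n' m' : ℕ} (f : Fin n → Fin n') (g : Fin m → Fin m') :
    Definable fun (A : Str σ) (e : Fin n' → A.U) (s : Fin m' → Set A.U) =>
      P A (fun i => e (f i)) (fun j => s (g j)) := by
  obtain ⟨φ, hφ⟩ := h
  exact ⟨φ.rename f g, fun A e s => (φ.sat_rename A f g e s).trans (hφ _ _ _)⟩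

theorem eq (i j : Fin n) :
    Definable fun (A : Str σ) (e : Fin n → A.U) (_ : Fin m → Set A.U) => e i = e j :=
  ⟨.eq i j, fun _ _ _ => Iff.rfl⟩

theorem mem (i : Fin n) (j : Fin m) :
    Definable fun (A : Str σ) (e : Fin n → A.U) (s : Fin m → Set A.U) => e i ∈ s j :=
  ⟨.mem i j, fun _ _ _ => Iff.rfl⟩

theorem rel (R : σ.Rel) (x : Fin (σ.elemArity R) → Fin n) (X : Fin (σ.setArity R) → Fin m) :
    Definable fun (A : Str σ) (e : Fin n → A.U) (s : Fin m → Set A.U) =>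
      A.rel R (fun i => e (x i)) (fun j => s (X j)) :=
  ⟨.rel R x X, fun _ _ _ => Iff.rfl⟩

theorem dvdCard {p : ℕ} (hp : 2 ≤ p) (j : Fin m) :
    Definable fun (A : Str σ) (_ : Fin n → A.U) (s : Fin m → Set A.U) => p ∣ (s j).ncard :=
  ⟨.dvdCard p hp j, fun _ _ _ => Iff.rfl⟩

theorem not {P : ∀ A : Str σ, (Fin n → A.U) → (Fin m → Set A.U) → Prop} (h : Definable P) :
    Definable fun A e s => ¬ P A e s := by
  obtain ⟨φ, hφ⟩ := h
  exact ⟨.not φ, fun A e s => not_congr (hφ A e s)⟩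

theorem and {P Q : ∀ A : Str σ, (Fin n → A.U) → (Fin m → Set A.U) → Prop} (h : Definable P)
    (h' : Definable Q) : Definable fun A e s => P A e s ∧ Q A e s := by
  obtain ⟨φ, hφ⟩ := h
  obtain ⟨ψ, hψ⟩ := h'
  exact ⟨.and φ ψ, fun A e s => and_congr (hφ A e s) (hψ A e s)⟩

theorem or {P Q : ∀ A : Str σ, (Fin n → A.U) → (Fin m → Set A.U) → Prop} (h : Definable P)
    (h' : Definable Q) : Definable fun A e s => P A e s ∨ Q A e s :=
  (h.not.and h'.not).not.congr fun _ _ _ => by tauto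

theorem imp {P Q : ∀ A : Str σ, (Fin n → A.U) → (Fin m → Set A.U) → Prop} (h : Definable P)
    (h' : Definable Q) : Definable fun A e s => P A e s → Q A e s :=
  (h.and h'.not).not.congr fun _ _ _ => by tauto

theorem iff {P Q : ∀ A : Str σ, (Fin n → A.U) → (Fin m → Set A.U) → Prop} (h : Definable P)
    (h' : Definable Q) : Definable fun A e s => (P A e s ↔ Q A e s) :=
  ((h.imp h').and (h'.imp h)).congr fun _ _ _ => by tauto

theorem exElem {Q : ∀ A : Str σ, A.U → (Fin n → A.U) → (Fin m → Set A.U) → Prop}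
    (h : Definable fun (A : Str σ) (e : Fin (n + 1) → A.U) s => Q A (e 0) (fun i => e i.succ) s) :
    Definable fun A e s => ∃ a, Q A a e s := by
  obtain ⟨φ, hφ⟩ := h
  exact ⟨.exElem φ, fun A e s => exists_congr fun a => (hφ _ _ _).trans (by simp)⟩

theorem allElem {Q : ∀ A : Str σ, A.U → (Fin n → A.U) → (Fin m → Set A.U) → Prop}
    (h : Definable fun (A : Str σ) (e : Fin (n + 1) → A.U) s => Q A (e 0) (fun i => e i.succ) s) :
    Definable fun A e s => ∀ a, Q A a e s :=
  (exElem (Q := fun A a e s => ¬ Q A a e s) h.not).not.congr fun _ _ _ => by simp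

theorem exSet {Q : ∀ A : Str σ, Set A.U → (Fin n → A.U) → (Fin m → Set A.U) → Prop}
    (h : Definable fun (A : Str σ) e (s : Fin (m + 1) → Set A.U) =>
      Q A (s 0) e (fun i => s i.succ)) :
    Definable fun A e s => ∃ a, Q A a e s := by
  obtain ⟨φ, hφ⟩ := h
  exact ⟨.exSet φ, fun A e s => exists_congr fun a => (hφ _ _ _).trans (by simp)⟩

theorem const (p : Prop) :
    Definable fun (A : Str σ) (_ : Fin n → A.U) (_ : Fin m → Set A.U) => p := by
  -- The syntax has no truth constants; this sentence is always true because universes are nonempty.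
  have h : Definable fun (A : Str σ) (_ : Fin n → A.U) (_ : Fin m → Set A.U) =>
      ∃ a b : A.U, a = b := exElem (exElem (eq _ _))
  by_cases hp : p
  · exact h.congr fun A _ _ => by
      simp only [hp, iff_true]
      exact ⟨Classical.choice A.nonempty, _, rfl⟩
  · exact h.not.congr fun A _ _ => by
      simp only [hp, iff_false, not_not]
      exact ⟨Classical.choice A.nonempty, _, rfl⟩

/-- Substitution of a definable set for a set variable. -/
theorem substSet {Q : ∀ A : Str σ, Set A.U → (Fin n → A.U) → (Fin m → Set A.U) → Prop}
    {S : ∀ A : Str σ, (Fin n → A.U) → (Fin m → Set A.U) → Set A.U}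
    (h : Definable fun (A : Str σ) e (s : Fin (m + 1) → Set A.U) =>
      Q A (s 0) e (fun i => s i.succ))
    (hS : Definable fun (A : Str σ) (e : Fin (n + 1) → A.U) s =>
      e 0 ∈ S A (fun i => e i.succ) s) :
    Definable fun A e s => Q A (S A e s) e s := by
  have : Definable fun A e s => ∃ T : Set A.U, (∀ a, a ∈ T ↔ a ∈ S A e s) ∧ Q A T e s :=
    exSet (and (allElem (iff (mem _ _) (hS.rename id Fin.succ))) h)
  refine this.congr fun A e s => ⟨?_, fun h => ⟨_, fun _ => Iff.rfl, h⟩⟩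
  rintro ⟨T, hT, hQ⟩
  rwa [Set.ext hT] at hQ

theorem exFinite {ι : Type*} [Finite ι]
    {P : ι → ∀ A : Str σ, (Fin n → A.U) → (Fin m → Set A.U) → Prop}
    (h : ∀ i, Definable (P i)) : Definable fun A e s => ∃ i, P i A e s := by
  classical
  cases nonempty_fintype ι
  suffices H : ∀ t : Finset ι, Definable fun A e s => ∃ i ∈ t, P i A e s from
    (H Finset.univ).congr fun _ _ _ => by simp
  intro t
  induction t using Finset.induction_on with
  | empty => exact (const False).congr fun _ _ _ => by simp
  | insert i t _ ih => exact ((h i).or ih).congr fun _ _ _ => by simp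

theorem allFinite {ι : Type*} [Finite ι]
    {P : ι → ∀ A : Str σ, (Fin n → A.U) → (Fin m → Set A.U) → Prop}
    (h : ∀ i, Definable (P i)) : Definable fun A e s => ∀ i, P i A e s :=
  (exFinite fun i => (h i).not).not.congr fun _ _ _ => by simp

theorem exElems {k : ℕ} {Q : ∀ A : Str σ, (Fin k → A.U) → (Fin n → A.U) → (Fin m → Set A.U) → Prop}
    (h : Definable fun (A : Str σ) (e : Fin (n + k) → A.U) s =>
      Q A (fun i => e (Fin.natAdd n i)) (fun i => e (Fin.castAdd k i)) s) :
    Definable fun A e s => ∃ t, Q A t e s := by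
  induction k with
  | zero =>
    exact h.congr fun A e s => ⟨fun h => ⟨_, h⟩, fun ⟨t, h⟩ => by
      rwa [Subsingleton.elim t] at h⟩
  | succ k ih =>
    have h' : Definable fun A e s => ∃ (t : Fin k → A.U) (a : A.U), Q A (Fin.cons a t) e s := by
      -- The block `t` occupies the last indices, whereas a quantifier binds index 0. The renaming
      -- moves the head of the block to index 0 and shifts everything else.
      refine ih (exElem ((h.rename (Fin.append (fun i => (Fin.castAdd k i).succ)
        (Fin.cons 0 fun i => (Fin.natAdd n i).succ : Fin (k + 1) → Fin (n + k + 1))) id).congr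
          fun A e s => ?_))
      simp only [Fin.append_right, Fin.append_left, id]
      have : (fun i => e ((Fin.cons 0 fun i => (Fin.natAdd n i).succ :
          Fin (k + 1) → Fin (n + k + 1)) i)) =
          (Fin.cons (e 0) fun i => e (Fin.natAdd n i).succ : Fin (k + 1) → A.U) := by
        funext i; refine Fin.cases ?_ (fun i => ?_) i <;> simp
      rw [this]
    refine h'.congr fun A e s => ⟨fun ⟨t, a, h⟩ => ⟨_, h⟩, fun ⟨t, h⟩ => ⟨Fin.tail t, t 0, ?_⟩⟩
    rwa [Fin.cons_self_tail]

theorem exSets {k : ℕ}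
    {Q : ∀ A : Str σ, (Fin k → Set A.U) → (Fin n → A.U) → (Fin m → Set A.U) → Prop}
    (h : Definable fun (A : Str σ) e (s : Fin (m + k) → Set A.U) =>
      Q A (fun i => s (Fin.natAdd m i)) e (fun i => s (Fin.castAdd k i))) :
    Definable fun A e s => ∃ t, Q A t e s := by
  induction k with
  | zero =>
    exact h.congr fun A e s => ⟨fun h => ⟨_, h⟩, fun ⟨t, h⟩ => by
      rwa [Subsingleton.elim t] at h⟩
  | succ k ih =>
    have h' : Definable fun A e s => ∃ (t : Fin k → Set A.U) (a : Set A.U),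
        Q A (Fin.cons a t) e s := by
      refine ih (exSet ((h.rename id (Fin.append (fun i => (Fin.castAdd k i).succ)
        (Fin.cons 0 fun i => (Fin.natAdd m i).succ : Fin (k + 1) → Fin (m + k + 1)))).congr
          fun A e s => ?_))
      simp only [Fin.append_right, Fin.append_left, id]
      have : (fun i => s ((Fin.cons 0 fun i => (Fin.natAdd m i).succ :
          Fin (k + 1) → Fin (m + k + 1)) i)) =
          (Fin.cons (s 0) fun i => s (Fin.natAdd m i).succ : Fin (k + 1) → Set A.U) := by
        funext i; refine Fin.cases ?_ (fun i => ?_) i <;> simp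
      rw [this]
    refine h'.congr fun A e s => ⟨fun ⟨t, a, h⟩ => ⟨_, h⟩, fun ⟨t, h⟩ => ⟨Fin.tail t, t 0, ?_⟩⟩
    rwa [Fin.cons_self_tail]

theorem allSets {k : ℕ}
    {Q : ∀ A : Str σ, (Fin k → Set A.U) → (Fin n → A.U) → (Fin m → Set A.U) → Prop}
    (h : Definable fun (A : Str σ) e (s : Fin (m + k) → Set A.U) =>
      Q A (fun i => s (Fin.natAdd m i)) e (fun i => s (Fin.castAdd k i))) :
    Definable fun A e s => ∀ t, Q A t e s :=
  (exSets (Q := fun A t e s => ¬ Q A t e s) h.not).not.congr fun _ _ _ => by simp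

end Definable

/-! ### Invariance under isomorphism -/

theorem Formula.sat_iso {σ : Vocabulary} {A B : Str σ} (f : A.Iso B) {n m : ℕ}
    (φ : Formula σ n m) : ∀ (e : Fin n → A.U) (s : Fin m → Set A.U),
      φ.Sat A e s ↔ φ.Sat B (fun i => f.toEquiv (e i)) (fun j => f.toEquiv '' s j) := by
  induction φ with
  | eq x y => intro e s; simp [Formula.Sat]
  | mem x X => intro e s; simp [Formula.Sat]
  | rel R x X => intro e s; exact f.map_rel _ _ _
  | dvdCard p hp X =>
    intro e s
    simp [Formula.Sat, Set.ncard_image_of_injective _ f.toEquiv.injective]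
  | not φ ih => intro e s; exact not_congr (ih e s)
  | and φ ψ ih ih' => intro e s; exact and_congr (ih e s) (ih' e s)
  | exElem φ ih =>
    intro e s
    refine f.toEquiv.exists_congr fun a => ?_
    rw [ih]
    have : (fun i => f.toEquiv ((Fin.cons a e : Fin _ → A.U) i))
        = (Fin.cons (f.toEquiv a) (fun i => f.toEquiv (e i)) : Fin _ → B.U) := by
      funext i; refine Fin.cases ?_ (fun i => ?_) i <;> simp
    rw [this]
  | exSet φ ih =>
    intro e s
    refine (Equiv.Set.congr f.toEquiv).exists_congr fun a => ?_
    rw [ih]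
    have : (fun i => f.toEquiv '' ((Fin.cons a s : Fin _ → Set A.U) i))
        = (Fin.cons (f.toEquiv '' a) (fun i => f.toEquiv '' (s i)) : Fin _ → Set B.U) := by
      funext i; refine Fin.cases ?_ (fun i => ?_) i <;> simp
    rw [this]
    rfl

theorem Interpretation.apply_iso {σ τ : Vocabulary} (I : Interpretation σ τ) {A B : Str σ}
    (f : A.Iso B) (h : Nonempty (I.Universe A)) :
    ∃ h' : Nonempty (I.Universe B), (I.apply A h).IsIso (I.apply B h') := by
  have hU : ∀ a : A.U, I.univ.Sat A (fun _ => a) Fin.elim0 ↔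
      I.univ.Sat B (fun _ => f.toEquiv a) Fin.elim0 := fun a => by
    rw [Formula.sat_iso f]
    exact iff_of_eq (congrArg _ (Subsingleton.elim _ _))
  let E : I.Universe A ≃ I.Universe B := f.toEquiv.subtypeEquiv hU
  refine ⟨h.map E, ⟨⟨E, fun R e s => ?_⟩⟩⟩
  change (I.rel R).Sat A _ _ ↔ (I.rel R).Sat B _ _
  rw [Formula.sat_iso f]
  have : (fun j => f.toEquiv '' (Subtype.val '' s j)) =
      fun j => Subtype.val '' (E '' s j) := by
    funext j
    exact (Set.image_image _ _ _).trans (Set.image_image Subtype.val E (s j)).symm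
  rw [this]
  rfl

theorem Str.copies_iso {σ : Vocabulary} {A B : Str σ} (h : A.IsIso B) (k : ℕ) (hk : 2 ≤ k) :
    (A.copies k hk).IsIso (B.copies k hk) := by
  obtain ⟨f⟩ := h
  let Φ : Fin k × A.U ≃ Fin k × B.U := (Equiv.refl _).prodCongr f.toEquiv
  refine ⟨⟨Φ, ?_⟩⟩
  rintro (R | _) e s
  · constructor
    · rintro ⟨c, e', s', h, rfl, rfl⟩
      exact ⟨c, _, _, (f.map_rel _ _ _).1 h, rfl, funext fun j =>
        (Set.image_image Φ (Prod.mk c) (s' j)).trans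
          (Set.image_image (Prod.mk c) f.toEquiv (s' j)).symm⟩
    · rintro ⟨c, e', s', h, he, hs⟩
      refine ⟨c, fun i => f.toEquiv.symm (e' i), fun j => f.toEquiv.symm '' s' j, ?_, ?_, ?_⟩
      · rw [f.map_rel]; simpa using h
      · refine funext fun i => Φ.injective (Eq.trans (congrFun he i) ?_)
        exact Prod.ext rfl (f.toEquiv.apply_symm_apply _).symm
      · refine funext fun j => Φ.injective.image_injective (Eq.trans (congrFun hs j) ?_)
        change Prod.mk c '' s' j = Φ '' (Prod.mk c '' (f.toEquiv.symm '' s' j))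
        rw [Set.image_image, Set.image_image]
        exact Set.image_congr fun a _ => Prod.ext rfl (f.toEquiv.apply_symm_apply _).symm
  · constructor
    · rintro ⟨a, rfl⟩
      exact ⟨f.toEquiv a, rfl⟩
    · rintro ⟨a, he⟩
      refine ⟨f.toEquiv.symm a, funext fun i => Φ.injective (Eq.trans (congrFun he i) ?_)⟩
      exact Prod.ext rfl (f.toEquiv.apply_symm_apply _).symm

/-- Outputs are only given up to isomorphism, so a composition passes through an arbitrary
isomorphic copy of the intermediate structure; this allows replacing the copy by a preferred one. -/
theorem IsMSOTransduction.iso_left {σ τ : Vocabulary} {f : Str σ → Str τ → Prop}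
    (hf : IsMSOTransduction f) : ∀ {A A' : Str σ} {B : Str τ}, f A B → A.IsIso A' → f A' B := by
  induction hf with
  | identity => exact fun h h' => h'.symm.trans h
  | interpretation I =>
    rintro A A' B ⟨h, h'⟩ h''
    obtain ⟨g⟩ := h''
    obtain ⟨h₁, h₂⟩ := I.apply_iso g h
    exact ⟨h₁, h₂.symm.trans h'⟩
  | filtering φ =>
    rintro A A' B ⟨h, h'⟩ ⟨g⟩
    refine ⟨?_, Str.IsIso.trans (Str.IsIso.symm ⟨g⟩) h'⟩
    rw [Formula.sat_iso g] at h
    convert h using 1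
  | copying k hk => exact fun h h' => (Str.copies_iso h'.symm k hk).trans h
  | colouring k hk =>
    rintro A A' B ⟨c, h⟩ ⟨g⟩
    refine ⟨fun a => c (g.toEquiv.symm a), Str.IsIso.trans (Str.IsIso.symm ⟨⟨g.toEquiv, ?_⟩⟩) h⟩
    rintro (R | i) e s
    · exact g.map_rel R e s
    · exact iff_of_eq (congrArg (fun x => c x = i) (g.toEquiv.symm_apply_apply _).symm)
  | comp hf hg ihf ihg => exact fun ⟨B, h, h'⟩ h'' => ⟨B, ihf h h'', h'⟩

theorem IsMSOTransduction.congr {σ τ : Vocabulary} {f g : Str σ → Str τ → Prop}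
    (hf : IsMSOTransduction f) (h : ∀ A B, f A B ↔ g A B) : IsMSOTransduction g := by
  have : f = g := by funext A B; exact propext (h A B)
  exact this ▸ hf

/-- Composition of a transduction whose outputs are known up to isomorphism with another one. -/
theorem IsMSOTransduction.comp_of_isIso {σ τ υ : Vocabulary} {f : Str σ → Str τ}
    {g : Str τ → Str υ → Prop} (hf : IsMSOTransduction fun A B => (f A).IsIso B)
    (hg : IsMSOTransduction g) : IsMSOTransduction fun A C => g (f A) C :=
  (hf.comp hg).congr fun _ _ =>
    ⟨fun ⟨_, h, h'⟩ => hg.iso_left h' h.symm, fun h => ⟨_, Str.IsIso.refl _, h⟩⟩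

theorem Encodes.trans {σ τ υ : Vocabulary} {C : StrClass σ} {D : StrClass τ} {E : StrClass υ}
    (h : Encodes C D) (h' : Encodes D E) : Encodes C E := by
  obtain ⟨f, g, ⟨hf, hfD⟩, ⟨hg, hgC⟩, hfg⟩ := h
  obtain ⟨f', g', ⟨hf', hfE⟩, ⟨hg', hgD⟩, hfg'⟩ := h'
  refine ⟨_, _, ⟨hf.comp hf', ?_⟩, ⟨hg'.comp hg, ?_⟩, ?_⟩
  · rintro A hA B ⟨X, hX, hX'⟩
    exact hfE X (hfD A hA X hX) B hX'
  · rintro A hA B ⟨X, hX, hX'⟩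
    exact hgC X (hgD A hA X hX) B hX'
  · intro A hA A'
    rw [← hfg A hA]
    constructor
    · rintro ⟨B, ⟨X, hX, hX'⟩, ⟨Y, hY, hY'⟩⟩
      exact ⟨X, hX, hg.iso_left hY' ((hfg' X (hfD A hA X hX) Y).1 ⟨B, hX', hY⟩).symm⟩
    · rintro ⟨X, hX, hX'⟩
      obtain ⟨B, hB, hB'⟩ := (hfg' X (hfD A hA X hX) X).2 (Str.IsIso.refl X)
      exact ⟨B, ⟨X, hX, hB⟩, ⟨X, hB', hX'⟩⟩

/-! ### Interpretations given by definable predicates -/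

/-- The structure on the elements with the property `P`, with relations given by `Q`. -/
def Str.interp {σ τ : Vocabulary} (A : Str σ) (P : A.U → Prop) (h : ∃ a, P a)
    (Q : ∀ R : τ.Rel, (Fin (τ.elemArity R) → A.U) → (Fin (τ.setArity R) → Set A.U) → Prop) :
    Str τ where
  U := {a // P a}
  finite := Subtype.finite
  nonempty := nonempty_subtype.2 h
  rel R e s := Q R (fun i => (e i).1) (fun j => Subtype.val '' s j)

/-- The structure with the universe of `A` and with relations given by `Q`. -/
def Str.withRel {σ τ : Vocabulary} (A : Str σ)
    (Q : ∀ R : τ.Rel, (Fin (τ.elemArity R) → A.U) → (Fin (τ.setArity R) → Set A.U) → Prop) :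
    Str τ where
  U := A.U
  finite := A.finite
  nonempty := A.nonempty
  rel := Q

/-- Lets interpretations be specified by semantic predicates, so that no later argument has to
handle the syntax of formulas. -/
theorem isMSOTransduction_interp {σ τ : Vocabulary} (P : ∀ A : Str σ, A.U → Prop)
    (Q : ∀ (A : Str σ) (R : τ.Rel), (Fin (τ.elemArity R) → A.U) →
      (Fin (τ.setArity R) → Set A.U) → Prop)
    (hP : Definable fun (A : Str σ) (e : Fin 1 → A.U) (_ : Fin 0 → Set A.U) => P A (e 0))
    (hQ : ∀ R, Definable fun (A : Str σ) e s => Q A R e s) :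
    IsMSOTransduction fun A B => ∃ h : ∃ a, P A a, (A.interp (P A) h (Q A)).IsIso B := by
  obtain ⟨φ, hφ⟩ := hP
  choose ψ hψ using hQ
  refine (IsMSOTransduction.interpretation ⟨φ, ψ⟩).congr fun A B => ?_
  have hU : ∀ a : A.U, φ.Sat A (fun _ => a) Fin.elim0 ↔ P A a := fun a => hφ A _ _
  have key : ∀ h h', ((Interpretation.mk φ ψ).apply A h).IsIso (A.interp (P A) h' (Q A)) := by
    intro h h'
    refine ⟨⟨(Equiv.refl _).subtypeEquiv hU, fun R e s => ?_⟩⟩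
    refine (hψ R A _ _).trans (iff_of_eq ?_)
    change Q A R _ _ = Q A R _ _
    congr 1
    funext j
    exact (Set.image_image Subtype.val ((Equiv.refl A.U).subtypeEquiv hU) (s j)).symm
  constructor
  · rintro ⟨⟨a⟩, h⟩
    exact ⟨⟨a.1, (hU _).1 a.2⟩, (key _ _).symm.trans h⟩
  · rintro ⟨⟨a, ha⟩, h⟩
    exact ⟨⟨⟨a, (hU _).2 ha⟩⟩, (key _ _).trans h⟩

theorem isMSOTransduction_withRel {σ τ : Vocabulary}
    (Q : ∀ (A : Str σ) (R : τ.Rel), (Fin (τ.elemArity R) → A.U) →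
      (Fin (τ.setArity R) → Set A.U) → Prop)
    (hQ : ∀ R, Definable fun (A : Str σ) e s => Q A R e s) :
    IsMSOTransduction fun A B => (A.withRel (Q A)).IsIso B := by
  refine (isMSOTransduction_interp (fun _ _ => True) Q (.const _) hQ).congr fun A B => ?_
  have h : ∃ _ : A.U, True := ⟨Classical.choice A.nonempty, trivial⟩
  have key : (A.withRel (Q A)).IsIso (A.interp (fun _ => True) h (Q A)) := by
    refine ⟨⟨(Equiv.Set.univ A.U).symm, fun R e s => iff_of_eq ?_⟩⟩
    change Q A R _ _ = Q A R _ _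
    congr 1
    funext j
    exact (Set.image_id _).symm.trans
      (Set.image_image Subtype.val (Equiv.Set.univ A.U).symm (s j)).symm
  exact ⟨fun ⟨_, h'⟩ => key.trans h', fun h' => ⟨h, key.symm.trans h'⟩⟩

theorem isMSOTransduction_filter {σ : Vocabulary} (P : Str σ → Prop)
    (hP : Definable fun (A : Str σ) (_ : Fin 0 → A.U) (_ : Fin 0 → Set A.U) => P A) :
    IsMSOTransduction fun A B => P A ∧ A.IsIso B := by
  obtain ⟨φ, hφ⟩ := hP
  exact (IsMSOTransduction.filtering φ).congr fun A B => and_congr_left' (hφ A _ _)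

/-! ### Definable functions with values in a finite type -/

/-- A function on structures with element and set parameters, with values in a fixed type, is
definable if all of its fibres are definable. -/
def DefinableFun {σ : Vocabulary} {n m : ℕ} {κ : Type*}
    (g : ∀ A : Str σ, (Fin n → A.U) → (Fin m → Set A.U) → κ) : Prop :=
  ∀ a, Definable fun A e s => g A e s = a

/-- Divisibility is the case of residue 0. A residue r + 1 < N forces the set to be nonempty, and
removing any one element lowers the residue to r. -/
theorem Definable.card_mod {σ : Vocabulary} {N : ℕ} (hN : 2 ≤ N) {r : ℕ} (hr : r < N) :
    ∀ {n m : ℕ} (j : Fin m), Definable fun (A : Str σ) (_ : Fin n → A.U) (s : Fin m → Set A.U) =>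
      (s j).ncard % N = r := by
  induction r with
  | zero => exact fun j => (dvdCard hN j).congr fun A _ s => Nat.dvd_iff_mod_eq_zero
  | succ r ih =>
    intro n m j
    have : Definable fun (A : Str σ) (_ : Fin n → A.U) (s : Fin m → Set A.U) =>
        ∃ a, a ∈ s j ∧ (s j \ {a}).ncard % N = r :=
      exElem (and (mem _ _) (substSet (Q := fun A T e s => T.ncard % N = r)
        (S := fun A e s => s j \ {e 0}) (ih (by omega) 0) (and (mem _ _) (not (eq _ _)))))
    refine this.congr fun A _ s => ⟨?_, fun h => ?_⟩
    · rintro ⟨a, ha, h⟩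
      rw [← Set.ncard_sdiff_singleton_add_one ha, Nat.add_mod, h, Nat.mod_eq_of_lt (by omega : 1 < N),
        Nat.mod_eq_of_lt hr]
    · have hne : (s j).Nonempty := by
        rw [Set.nonempty_iff_ne_empty]
        rintro h0
        simp [h0] at h
      obtain ⟨a, ha⟩ := hne
      refine ⟨a, ha, ?_⟩
      have h1 := Set.ncard_sdiff_singleton_add_one ha
      rw [← h1, ← Nat.mod_eq_of_lt hr] at h
      have := Nat.ModEq.add_right_cancel' 1 (show _ ≡ _ [MOD N] from h)
      rwa [Nat.ModEq, Nat.mod_eq_of_lt (by omega : r < N)] at this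

namespace DefinableFun

variable {σ : Vocabulary} {n m : ℕ} {κ κ' : Type*}

theorem congr {f g : ∀ A : Str σ, (Fin n → A.U) → (Fin m → Set A.U) → κ}
    (hf : DefinableFun f) (h : ∀ A e s, f A e s = g A e s) : DefinableFun g :=
  fun a => (hf a).congr fun A e s => by rw [h]

theorem map [Finite κ] {g : ∀ A : Str σ, (Fin n → A.U) → (Fin m → Set A.U) → κ}
    (hg : DefinableFun g) (h : κ → κ') : DefinableFun fun A e s => h (g A e s) := fun b =>
  (Definable.exFinite fun a : κ => (hg a).and (.const (h a = b))).congr fun A e s => by simp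

theorem pi {ι : Type*} [Finite ι] {g : ι → ∀ A : Str σ, (Fin n → A.U) → (Fin m → Set A.U) → κ}
    (hg : ∀ i, DefinableFun (g i)) : DefinableFun fun A e s i => g i A e s := fun b =>
  (Definable.allFinite fun i => hg i (b i)).congr fun A e s => by simp [funext_iff]

theorem map₂ {κ'' : Type*} [Finite κ] [Finite κ']
    {g : ∀ A : Str σ, (Fin n → A.U) → (Fin m → Set A.U) → κ}
    {g' : ∀ A : Str σ, (Fin n → A.U) → (Fin m → Set A.U) → κ'}
    (hg : DefinableFun g) (hg' : DefinableFun g') (h : κ → κ' → κ'') :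
    DefinableFun fun A e s => h (g A e s) (g' A e s) := fun b =>
  (Definable.exFinite fun p : κ × κ' => ((hg p.1).and (hg' p.2)).and (.const (h p.1 p.2 = b))).congr
    fun A e s => ⟨by rintro ⟨p, ⟨h1, h2⟩, h3⟩; rwa [← h1, ← h2] at h3, fun h => ⟨(_, _), ⟨rfl, rfl⟩, h⟩⟩

theorem eq [Finite κ] {g g' : ∀ A : Str σ, (Fin n → A.U) → (Fin m → Set A.U) → κ}
    (hg : DefinableFun g) (hg' : DefinableFun g') : Definable fun A e s => g A e s = g' A e s :=
  (Definable.exFinite fun a : κ => (hg a).and (hg' a)).congr fun A e s =>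
    ⟨by rintro ⟨p, h1, h2⟩; rw [h1, h2], fun h => ⟨_, h, rfl⟩⟩

open Classical in
theorem ite {P : ∀ A : Str σ, (Fin n → A.U) → (Fin m → Set A.U) → Prop} (hP : Definable P)
    (a b : κ) : DefinableFun fun A e s => if P A e s then a else b := fun x =>
  ((hP.and (.const (a = x))).or (hP.not.and (.const (b = x)))).congr fun A e s => by
    by_cases h : P A e s <;> simp [h]

theorem sum {ι : Type*} [Fintype ι] [Finite κ] [AddCommMonoid κ]
    {g : ι → ∀ A : Str σ, (Fin n → A.U) → (Fin m → Set A.U) → κ}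
    (hg : ∀ i, DefinableFun (g i)) : DefinableFun fun A e s => ∑ i, g i A e s :=
  (pi hg).map fun f => ∑ i, f i

theorem finsum [Finite κ] [AddCommGroup κ]
    {g : ∀ A : Str σ, A.U → (Fin n → A.U) → (Fin m → Set A.U) → κ}
    (hg : DefinableFun fun (A : Str σ) (e : Fin (n + 1) → A.U) s =>
      g A (e 0) (fun i => e i.succ) s) :
    DefinableFun fun A e s => ∑ᶠ x, g A x e s := by
  classical
  cases nonempty_fintype κ
  have hpos : 0 < Nat.card κ := Nat.card_pos
  -- This multiple of the group order annihilates `κ`, so fibre sizes matter only modulo `N`; the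
  -- factor 2 ensures `2 ≤ N` even for the trivial group.
  let N := 2 * Nat.card κ
  have hN : 2 ≤ N := by omega
  let C : ∀ (a : κ) (A : Str σ), (Fin n → A.U) → (Fin m → Set A.U) → Fin N :=
    fun a A e s => ⟨{x | g A x e s = a}.ncard % N, Nat.mod_lt _ (by omega)⟩
  have hC : ∀ a, DefinableFun (C a) := by
    intro a r
    refine (Definable.substSet (Q := fun A T e s => T.ncard % N = r)
      (S := fun A e s => {x | g A x e s = a}) (Definable.card_mod hN r.2 0) (hg a)).congr
        fun A e s => ?_
    simp [C, Fin.ext_iff]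
  refine ((pi hC).map fun f => ∑ a, (f a : ℕ) • a).congr fun A e s => ?_
  cases nonempty_fintype A.U
  rw [finsum_eq_sum_of_fintype, ← Finset.sum_fiberwise Finset.univ fun x => g A x e s]
  refine Finset.sum_congr rfl fun a _ => ?_
  have h0 : N • a = 0 := by
    rw [mul_smul, card_nsmul_eq_zero', smul_zero]
  have h1 : ∑ x with g A x e s = a, g A x e s = {x | g A x e s = a}.ncard • a := by
    rw [Finset.sum_congr rfl fun x hx => (Finset.mem_filter.1 hx).2, Finset.sum_const,
      Set.ncard_eq_toFinset_card']
    simp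
  rw [h1]
  simp only [C]
  conv_rhs => rw [← Nat.mod_add_div {x | g A x e s = a}.ncard N, add_smul, mul_comm, mul_smul,
    h0, smul_zero, add_zero]

end DefinableFun

/-! ### Null representations from matrices -/

theorem Definable.rel_of_eq {σ : Vocabulary} {n m : ℕ} (R : σ.Rel)
    {t : ∀ A : Str σ, (Fin n → A.U) → Fin (σ.elemArity R) → A.U}
    {u : ∀ A : Str σ, (Fin m → Set A.U) → Fin (σ.setArity R) → Set A.U}
    (x : Fin (σ.elemArity R) → Fin n) (X : Fin (σ.setArity R) → Fin m)
    (ht : ∀ A e i, t A e i = e (x i)) (hu : ∀ A s j, u A s j = s (X j)) :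
    Definable fun (A : Str σ) e s => A.rel R (t A e) (u A s) :=
  (Definable.rel R x X).congr fun A e s => by
    rw [show t A e = fun i => e (x i) from funext (ht A e),
      show u A s = fun j => s (X j) from funext (hu A s)]

open Classical in
/-- The coefficient of `x` in the linear combination with coefficients `c` of the indicator
functions of the sets `X i`. -/
noncomputable def coef {k : Type*} [AddCommMonoid k] {n : ℕ} (c : Fin n → k) {U : Type}
    (X : Fin n → Set U) (x : U) : k :=
  ∑ i, if x ∈ X i then c i else 0

/-- The hypothesis `hc` is all that is needed of the coefficients: at each point, choose the index
set whose coefficients add up to the desired value. Quantifying over tuples of sets then amounts to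
quantifying over linear combinations. -/
theorem exists_coef_eq {k : Type*} [AddCommMonoid k] {n : ℕ} {c : Fin n → k}
    (hc : ∀ a, ∃ I : Finset (Fin n), ∑ i ∈ I, c i = a) {U : Type} (l : U → k) :
    ∃ X : Fin n → Set U, ∀ x, coef c X x = l x := by
  choose I hI using hc
  refine ⟨fun i => {x | i ∈ I (l x)}, fun x => ?_⟩
  classical
  calc coef c (fun i => {x | i ∈ I (l x)}) x = ∑ i, if i ∈ I (l x) then c i else 0 :=
        Finset.sum_congr rfl fun i _ => by by_cases h : i ∈ I (l x) <;> simp [h]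
    _ = l x := by simp [hI]

theorem DefinableFun.coef {σ : Vocabulary} {k : Type*} [AddCommMonoid k] [Finite k] {n : ℕ}
    (c : Fin n → k) {a b : ℕ} (f : Fin n → Fin b) (i : Fin a) :
    DefinableFun fun (A : Str σ) (e : Fin a → A.U) (s : Fin b → Set A.U) =>
      coef c (fun j => s (f j)) (e i) :=
  .sum fun _ => .ite (.mem _ _) _ _

/-- The vocabulary with `N` binary relation names. -/
def binariesVocabulary (N : ℕ) : Vocabulary where
  Rel := Fin N
  elemArity _ := 2
  setArity _ := 0

/-- The `i`-th binary relation of a structure with `N` binary relations. -/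
def Str.bin {N : ℕ} (A : Str (binariesVocabulary N)) (i : Fin N) (x y : A.U) : Prop :=
  A.rel i (![x, y] : Fin 2 → A.U) Fin.elim0

theorem Definable.bin {N : ℕ} (i : Fin N) {a b : ℕ} (x y : Fin a) :
    Definable fun (A : Str (binariesVocabulary N)) (e : Fin a → A.U) (_ : Fin b → Set A.U) =>
      A.bin i (e x) (e y) :=
  .rel_of_eq (σ := binariesVocabulary N) i (![x, y] : Fin 2 → Fin a) Fin.elim0
    (fun A e j => by revert j; exact Fin.forall_fin_two.2 ⟨rfl, rfl⟩) fun A s j => j.elim0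

open Classical in
/-- The matrix given by one binary relation for each of the scalars `en i`. -/
noncomputable def relEntry {k : Type*} [AddCommMonoid k] {N : ℕ} (en : Fin N → k) {U : Type}
    (R : Fin N → U → U → Prop) (x y : U) : k :=
  ∑ i, if R i x y then en i else 0

/-- The null structure of the family of the rows of the matrix of `A`. -/
noncomputable def Str.matNull {k : Type*} [Semiring k] {N n : ℕ} (en : Fin N → k) (c : Fin n → k)
    (A : Str (binariesVocabulary N)) : Str (setVocabulary n) :=
  A.withRel fun _ _ X => ∀ y, ∑ᶠ x, coef c X x * relEntry en A.bin x y = 0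

theorem DefinableFun.relEntry {k : Type*} [AddCommMonoid k] [Finite k] {N : ℕ} (en : Fin N → k)
    {a b : ℕ} (x y : Fin a) :
    DefinableFun fun (A : Str (binariesVocabulary N)) (e : Fin a → A.U) (_ : Fin b → Set A.U) =>
      MSO.relEntry en A.bin (e x) (e y) :=
  .sum fun i => .ite (.bin i x y) (en i) 0

/-- The sums take values in a finite ring, hence are definable by modulo counting. As `relEntry` is
a sum, any `N` binary relations give a matrix, so this decoding needs no check of its input. -/
theorem isMSOTransduction_matNull {k : Type*} [Ring k] [Finite k] {N n : ℕ} (en : Fin N → k)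
    (c : Fin n → k) : IsMSOTransduction fun A B => (Str.matNull en c A).IsIso B := by
  have h0 : DefinableFun fun (A : Str (binariesVocabulary N)) (e : Fin 1 → A.U)
      (X : Fin n → Set A.U) => ∑ᶠ x, MSO.coef c X x * relEntry en A.bin x (e 0) :=
    DefinableFun.finsum (g := fun A x e (X : Fin n → Set A.U) =>
      MSO.coef c X x * relEntry en A.bin x (e 0))
        (DefinableFun.map₂ (.coef c (fun i => i) 0) (.relEntry en 0 1) (· * ·))
  have h : Definable fun (A : Str (binariesVocabulary N)) (_ : Fin 0 → A.U)
      (X : Fin n → Set A.U) => ∀ y, ∑ᶠ x, MSO.coef c X x * relEntry en A.bin x y = 0 :=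
    .allElem (h0 0)
  exact isMSOTransduction_withRel _ fun _ => h

/-! ### From null structures to matrices -/

/-- The only linear relation between the vectors of `B` is the trivial one. -/
def Indep {k U W : Type*} [Field k] [Fintype U] [AddCommGroup W] [Module k W] (v : U → W)
    (B : Set U) : Prop :=
  ∀ l : U → k, ∑ x, l x • v x = 0 → (∀ x, x ∉ B → l x = 0) → ∀ x, l x = 0

open Classical in
/-- Each vector is a linear combination of vectors of `B`. -/
def Spans {k U W : Type*} [Field k] [Fintype U] [AddCommGroup W] [Module k W] (v : U → W)
    (B : Set U) : Prop :=
  ∀ e : U, ∃ l : U → k, ∑ x, l x • v x = 0 ∧ ∀ x, x ∉ B → l x = if x = e then 1 else 0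

theorem exists_indep_spans (k : Type*) {U W : Type*} [Field k] [Fintype U] [AddCommGroup W]
    [Module k W] (v : U → W) : ∃ B : Set U, Indep (k := k) v B ∧ Spans (k := k) v B := by
  classical
  obtain ⟨B, hB, hmax⟩ := Set.Finite.exists_maximal
    (Set.toFinite {B : Set U | Indep (k := k) v B}) ⟨∅, fun l _ h x => h x (by simp)⟩
  refine ⟨B, hB, fun e => ?_⟩
  by_cases he : e ∈ B
  -- For an element of the base the zero relation serves, because the condition on coefficients
  -- concerns only points outside `B`.
  · refine ⟨0, by simp, fun x hx => ?_⟩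
    rw [if_neg (by rintro rfl; exact hx he)]
    rfl
  · have hn : ¬ Indep (k := k) v (insert e B) := fun h =>
      he (hmax h (Set.subset_insert _ _) (Set.mem_insert _ _))
    simp only [Indep, not_forall] at hn
    obtain ⟨l, h0, hl, x, hx⟩ := hn
    have hle : l e ≠ 0 := fun h => hx (hB l h0 (fun y hy => by
      by_cases hye : y = e
      · rw [hye, h]
      · exact hl y (by simp [hye, hy])) x)
    refine ⟨fun x => (l e)⁻¹ * l x, ?_, fun y hy => ?_⟩
    · simp only [mul_smul, ← Finset.smul_sum, h0, smul_zero]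
    · split_ifs with hye
      · simp only [hye, inv_mul_cancel₀ hle]
      · simp only [hl y (by simp [hye, hy]), mul_zero]

open Classical in
-- The numbers δ − `l x y` are the coordinates of `v x` over `B`, and they vanish for `y` outside
-- `B`. By independence of `B`, a combination of the vectors is zero iff all its coordinates are.
theorem sum_smul_eq_zero_iff {k U W : Type*} [Field k] [Fintype U] [AddCommGroup W] [Module k W]
    {v : U → W} {B : Set U} (hB : Indep (k := k) v B) {l : U → U → k}
    (hl : ∀ e, ∑ x, l e x • v x = 0) (hlB : ∀ e x, x ∉ B → l e x = if x = e then 1 else 0)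
    (r : U → k) :
    (∀ y, ∑ x, r x * ((if y = x then 1 else 0) - l x y) = 0) ↔ ∑ x, r x • v x = 0 := by
  have h1 : ∀ x, v x = ∑ y, ((if y = x then (1 : k) else 0) - l x y) • v y := fun x => by
    simp [sub_smul, hl]
  have h2 : ∑ x, r x • v x = ∑ y, (∑ x, r x * ((if y = x then 1 else 0) - l x y)) • v y := by
    simp only [Finset.sum_smul]
    rw [Finset.sum_comm]
    refine Finset.sum_congr rfl fun x _ => ?_
    conv_lhs => rw [h1 x, Finset.smul_sum]
    simp only [mul_smul]
  constructor
  · intro h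
    simp [h2, h]
  · intro h
    rw [h2] at h
    exact hB _ h fun y hy => Finset.sum_eq_zero fun x _ => by rw [hlB x y hy, sub_self, mul_zero]

section NullToMatrix

variable {k : Type*} [Field k] {N n : ℕ} (en : Fin N → k) (c : Fin n → k)

/-- The null relation of a null structure with colours. -/
def Str.nul (A : Str ((setVocabulary n).addColours 2)) (X : Fin n → Set A.U) : Prop :=
  A.rel (.inl ()) Fin.elim0 X

/-- The elements of the first colour. -/
def Str.col (A : Str ((setVocabulary n).addColours 2)) (x : A.U) : Prop :=
  A.rel (.inr 0) (fun _ => x) Fin.elim0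

open Classical in
/-- `X` is a linear relation that expresses `e` in terms of the elements of `B`. -/
def Expresses {U : Type} (nul : (Fin n → Set U) → Prop) (B : U → Prop) (e : U)
    (X : Fin n → Set U) : Prop :=
  nul X ∧ ∀ x, ¬ B x → coef c X x = if x = e then 1 else 0

/-- The elements of `B` are a base. -/
def IsNullBase {U : Type} (nul : (Fin n → Set U) → Prop) (B : U → Prop) : Prop :=
  (¬ ∃ X, (nul X ∧ ∀ x, ¬ B x → coef c X x = 0) ∧ ¬ ∀ x, coef c X x = 0) ∧
    ∀ e, ∃ X, Expresses c nul B e X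

open Classical in
/-- The coordinate at `y` of `e` with respect to the base `B` is `a`. -/
def IsCoord {U : Type} (nul : (Fin n → Set U) → Prop) (B : U → Prop) (a : k) (e y : U) : Prop :=
  B y ∧ ∃ X, Expresses c nul B e X ∧ (if y = e then 1 else 0) - coef c X y = a

/-- The matrix of the coordinates with respect to the base of elements of the first colour. -/
def Str.coords (A : Str ((setVocabulary n).addColours 2)) : Str (binariesVocabulary N) :=
  A.withRel fun i (e : Fin 2 → A.U) _ => IsCoord c A.nul A.col (en i) (e 0) (e 1)

theorem Definable.nul {a b : ℕ} (f : Fin n → Fin b) :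
    Definable fun (A : Str ((setVocabulary n).addColours 2)) (_ : Fin a → A.U)
      (s : Fin b → Set A.U) => A.nul fun i => s (f i) :=
  .rel_of_eq (σ := (setVocabulary n).addColours 2) (.inl ()) Fin.elim0 f
    (fun _ _ j => j.elim0) fun _ _ _ => rfl

theorem Definable.col {a b : ℕ} (x : Fin a) :
    Definable fun (A : Str ((setVocabulary n).addColours 2)) (e : Fin a → A.U)
      (_ : Fin b → Set A.U) => A.col (e x) :=
  .rel_of_eq (σ := (setVocabulary n).addColours 2) (.inr 0) (fun _ => x) Fin.elim0
    (fun _ _ _ => rfl) fun _ _ j => j.elim0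

variable [Finite k]

theorem Definable.expresses {a b : ℕ} (x : Fin a) (f : Fin n → Fin b) :
    Definable fun (A : Str ((setVocabulary n).addColours 2)) (e : Fin a → A.U)
      (s : Fin b → Set A.U) => Expresses c A.nul A.col (e x) fun i => s (f i) :=
  .and (.nul f) (.allElem (.imp (.not (.col _))
    (DefinableFun.eq (.coef c _ _) (.ite (.eq _ _) 1 0))))

theorem definable_colBase :
    Definable fun (A : Str ((setVocabulary n).addColours 2)) (_ : Fin 0 → A.U)
      (_ : Fin 0 → Set A.U) => IsNullBase c A.nul A.col :=
  .and (.not (.exSets (.and (.and (.nul _) (.allElem (.imp (.not (.col _))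
    (DefinableFun.coef c _ _ _))))
    (.not (.allElem (DefinableFun.coef c _ _ _)))))) (.allElem (.exSets (.expresses c _ _)))

theorem isMSOTransduction_coords :
    IsMSOTransduction fun (A : Str (setVocabulary n)) B => ∃ χ : A.U → Fin 2,
      IsNullBase c (A.colour χ).nul (A.colour χ).col ∧ ((A.colour χ).coords en c).IsIso B := by
  have h1 : IsMSOTransduction fun A B =>
      (Str.coords (N := N) en c A).IsIso B := by
    refine isMSOTransduction_withRel _ fun i => ?_
    refine .and (.col (1 : Fin 2)) (.exSets (.and (.expresses c (0 : Fin 2) _) ?_))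
    exact DefinableFun.map₂ (κ := k) (.ite (.eq _ _) _ _) (.coef c _ _) (· - ·) _
  have h2 := isMSOTransduction_filter _ (definable_colBase (n := n) c)
  refine (((IsMSOTransduction.colouring 2 (by norm_num)).comp h2).comp h1).congr fun A B => ?_
  constructor
  · rintro ⟨X, ⟨Y, ⟨χ, hχ⟩, hY⟩, hX⟩
    refine ⟨χ, ?_⟩
    obtain ⟨h3, h4⟩ := h2.iso_left hY hχ.symm
    exact ⟨h3, h1.iso_left hX h4.symm⟩
  · rintro ⟨χ, hχ, h⟩
    exact ⟨_, ⟨_, ⟨χ, Str.IsIso.refl _⟩, hχ, Str.IsIso.refl _⟩, h⟩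

end NullToMatrix

/-! ### Recovering a null structure from coordinates over a base -/

section

variable {k : Type*} [Field k] {n N : ℕ} {c : Fin n → k}

theorem isNullBase_iff {U : Type} [Fintype U] {W : Type*} [AddCommGroup W] [Module k W]
    {v : U → W} (hc : ∀ a, ∃ I : Finset (Fin n), ∑ i ∈ I, c i = a)
    {nul : (Fin n → Set U) → Prop} (hnul : ∀ X, nul X ↔ ∑ x, coef c X x • v x = 0)
    (B : U → Prop) :
    IsNullBase c nul B ↔ Indep (k := k) v {x | B x} ∧ Spans (k := k) v {x | B x} := by
  refine and_congr ?_ (forall_congr' fun e => ?_)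
  · rw [not_exists]
    constructor
    · intro h l hl hl' x
      obtain ⟨X, hX⟩ := exists_coef_eq hc l
      have := h X
      rw [not_and_not_right] at this
      rw [← hX]
      refine this ⟨(hnul X).2 (by simpa only [hX] using hl), fun x hx => ?_⟩ x
      rw [hX]
      exact hl' x hx
    · rintro h X ⟨⟨h1, h2⟩, h3⟩
      exact h3 (h _ ((hnul X).1 h1) h2)
  · constructor
    · rintro ⟨X, h1, h2⟩
      exact ⟨_, (hnul X).1 h1, h2⟩
    · rintro ⟨l, h1, h2⟩
      obtain ⟨X, hX⟩ := exists_coef_eq hc l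
      refine ⟨X, (hnul X).2 (by simpa only [hX] using h1), fun x hx => ?_⟩
      rw [hX]
      exact h2 x hx

theorem nul_iff_coords {U : Type} [Fintype U] {W : Type*} [AddCommGroup W] [Module k W]
    {v : U → W} (hc : ∀ a, ∃ I : Finset (Fin n), ∑ i ∈ I, c i = a) (en : Fin N ≃ k)
    {nul : (Fin n → Set U) → Prop} (hnul : ∀ X, nul X ↔ ∑ x, coef c X x • v x = 0)
    {B : U → Prop} (hB : IsNullBase c nul B) (Y : Fin n → Set U) :
    (∀ y, ∑ᶠ x, coef c Y x * relEntry en (fun i => IsCoord c nul B (en i)) x y = 0) ↔ nul Y := by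
  obtain ⟨hi, -⟩ := (isNullBase_iff hc hnul B).1 hB
  choose X hX using hB.2
  have hl : ∀ e, ∑ x, coef c (X e) x • v x = 0 := fun e => (hnul _).1 (hX e).1
  -- Two relations expressing `e` differ by a relation supported on the base, so coordinates are
  -- unique and each matrix entry has exactly one scalar.
  have huniq : ∀ e Y, Expresses c nul B e Y → ∀ x, coef c Y x = coef c (X e) x := by
    intro e Y hY x
    refine sub_eq_zero.1 (hi (fun x => coef c Y x - coef c (X e) x) ?_ (fun x hx => ?_) x)
    · simp [sub_smul, hl, (hnul _).1 hY.1]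
    · exact sub_eq_zero.2 ((hY.2 x hx).trans ((hX e).2 x hx).symm)
  classical
  have hentry : ∀ x y, relEntry en (fun i => IsCoord c nul B (en i)) x y =
      (if y = x then 1 else 0) - coef c (X x) y := by
    intro x y
    have hb : ∀ i : Fin N, IsCoord c nul B (en i) x y ↔
        B y ∧ (if y = x then 1 else 0) - coef c (X x) y = en i := by
      intro i
      refine and_congr_right fun _ => ⟨?_, fun h => ⟨X x, hX x, ?_⟩⟩
      · rintro ⟨Y, hY, h⟩
        rw [← huniq x Y hY, ← h]
      · rw [← h]
    rw [relEntry]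
    by_cases hy : B y
    · rw [Finset.sum_eq_single (en.symm ((if y = x then 1 else 0) - coef c (X x) y)),
        if_pos ((hb _).2 ⟨hy, by simp⟩), en.apply_symm_apply]
      · intro i _ hi
        rw [if_neg]
        rintro h
        exact hi (by rw [((hb i).1 h).2]; simp)
      · simp
    -- Outside the base no relation holds, so the entry is an empty sum; the formula for the
    -- coordinate gives δ − δ = 0 there.
    · rw [Finset.sum_eq_zero, (hX x).2 y hy, eq_comm, sub_eq_zero]
      · intro i _
        rw [if_neg]
        exact fun h => hy ((hb i).1 h).1
  rw [hnul]
  simp only [hentry, finsum_eq_sum_of_fintype]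
  have := sum_smul_eq_zero_iff hi hl (fun e x hx => ((hX e).2 x hx)) (coef c Y)
  convert this

end

/-- The null relation of `A` is the one of the family of vectors `v`. -/
def IsNullRel {k W : Type*} [Field k] [AddCommGroup W] [Module k W] {n : ℕ} (c : Fin n → k)
    (A : Str (setVocabulary n)) (v : A.U → W) : Prop :=
  ∀ (e : Fin 0 → A.U) (X : Fin n → Set A.U),
    A.rel () e X ↔ ∑ᶠ x, coef c X x • v x = 0

theorem IsNullRel.nul_iff {k W : Type*} [Field k] [AddCommGroup W] [Module k W] {n : ℕ}
    {c : Fin n → k} {A : Str (setVocabulary n)} {v : A.U → W} [Fintype A.U] (hv : IsNullRel c A v)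
    (X : Fin n → Set A.U) : A.rel () Fin.elim0 X ↔ ∑ x, coef c X x • v x = 0 := by
  rw [← finsum_eq_sum_of_fintype]
  exact hv _ X

theorem matNull_coords {k W : Type*} [Field k] [AddCommGroup W] [Module k W] {N n : ℕ}
    {c : Fin n → k} {A : Str (setVocabulary n)} {v : A.U → W} (χ : A.U → Fin 2)
    (hc : ∀ a, ∃ I : Finset (Fin n), ∑ i ∈ I, c i = a) (en : Fin N ≃ k) (hv : IsNullRel c A v)
    (hχ : IsNullBase c (A.colour χ).nul (A.colour χ).col) :
    (Str.matNull en c ((A.colour χ).coords en c)).IsIso A := by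
  cases nonempty_fintype A.U
  refine ⟨⟨Equiv.refl A.U, fun R e Y => ?_⟩⟩
  have hid : (fun j => (Equiv.refl A.U) '' Y j) = Y := funext fun j => Set.image_id _
  refine Iff.trans ?_ (iff_of_eq (congrArg (A.rel R _) hid.symm))
  refine (nul_iff_coords hc en hv.nul_iff hχ Y).trans (iff_of_eq ?_)
  exact congrArg (fun e => A.rel R e Y) (funext fun j : Fin 0 => j.elim0)

/-- The class of all structures over a vocabulary. -/
def allStr (σ : Vocabulary) : StrClass σ where
  carrier := Set.univ
  iso_closed _ _ _ _ := trivial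

/-- The guess of a base is nondeterministic, but every base decodes to the same null structure, and
the existence of a base guarantees an output. -/
theorem encodes_binaries {k : Type*} [Field k] [Finite k] {N n : ℕ} (en : Fin N ≃ k)
    {c : Fin n → k} (hc : ∀ a, ∃ I : Finset (Fin n), ∑ i ∈ I, c i = a)
    {C : StrClass (setVocabulary n)} (hC : ∀ A ∈ C.carrier, ∃ (W : Type*) (_ : AddCommGroup W)
      (_ : Module k W) (v : A.U → W), IsNullRel c A v)
    (hC' : ∀ A, Str.matNull en c A ∈ C.carrier) : Encodes C (allStr (binariesVocabulary N)) := by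
  refine ⟨_, _, ⟨isMSOTransduction_coords en c, fun _ _ _ _ => trivial⟩,
    ⟨isMSOTransduction_matNull en c, fun A _ B h => C.iso_closed _ _ h (hC' A)⟩,
    fun A hA A' => ?_⟩
  obtain ⟨W, _, _, v, hv⟩ := hC A hA
  constructor
  · rintro ⟨M, ⟨χ, hχ, hM⟩, h⟩
    exact (matNull_coords χ hc en hv hχ).symm.trans
      ((isMSOTransduction_matNull en c).iso_left h hM.symm)
  · intro h
    cases nonempty_fintype A.U
    obtain ⟨B, hB⟩ := exists_indep_spans k v
    classical
    let χ : A.U → Fin 2 := fun x => if x ∈ B then 0 else 1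
    have hχB : {x | χ x = 0} = B := by ext x; simp [χ]
    have hχ := (isNullBase_iff hc hv.nul_iff (χ · = 0)).2 (by rwa [hχB])
    exact ⟨_, ⟨χ, hχ, Str.IsIso.refl _⟩, (matNull_coords χ hc en hv hχ).trans h⟩

theorem Str.rel_congr {σ : Vocabulary} (A : Str σ) {R : σ.Rel}
    {e e' : Fin (σ.elemArity R) → A.U} {s s' : Fin (σ.setArity R) → Set A.U}
    (he : ∀ i, e i = e' i) (hs : ∀ j, s j = s' j) : A.rel R e s ↔ A.rel R e' s' := by
  rw [funext he, funext hs]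

/-! ### Definable relations in copies of a structure -/

section Copies

variable {σ : Vocabulary} {N k : ℕ}

/-- `x` and `y` are the `i`-th and the `j`-th copy of one element. -/
def Str.SameBase (A : Str (σ.addRel k)) (i j : Fin k) (x y : A.U) : Prop :=
  ∃ t : Fin k → A.U, A.rel (Sum.inr ()) t Fin.elim0 ∧ t i = x ∧ t j = y

/-- `x` is the `i`-th copy of an element and `y` is the `j`-th copy of an element, and these
elements are related by the binary relation `R`. -/
def Str.RelAt (A : Str ((binariesVocabulary N).addRel k)) (z i j : Fin k) (R : Fin N)
    (x y : A.U) : Prop :=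
  ∃ x' y', A.SameBase z i x' x ∧ A.SameBase z j y' y ∧
    A.rel (Sum.inl R) (![x', y'] : Fin 2 → A.U) Fin.elim0

theorem Definable.sameBase {a b : ℕ} (i j : Fin k) (x y : Fin a) :
    Definable fun (A : Str (σ.addRel k)) (e : Fin a → A.U) (_ : Fin b → Set A.U) =>
      A.SameBase i j (e x) (e y) := by
  have h : Definable fun (A : Str (σ.addRel k)) (e : Fin (a + k) → A.U) (_ : Fin b → Set A.U) =>
      A.rel (Sum.inr ()) (fun i : Fin k => e (Fin.natAdd a i)) Fin.elim0 :=
    .rel_of_eq (σ := σ.addRel k) (Sum.inr ()) (Fin.natAdd a) Fin.elim0 (fun _ _ _ => rfl)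
      fun _ _ j => j.elim0
  exact .exElems (.and h (.and (.eq _ _) (.eq _ _)))

theorem Definable.relAt {a b : ℕ} (z i j : Fin k) (R : Fin N) (x y : Fin a) :
    Definable fun (A : Str ((binariesVocabulary N).addRel k)) (e : Fin a → A.U)
      (_ : Fin b → Set A.U) => A.RelAt z i j R (e x) (e y) :=
  .exElem (.exElem (.and (.sameBase z i 1 x.succ.succ) (.and (.sameBase z j 0 y.succ.succ)
    (.rel_of_eq (σ := (binariesVocabulary N).addRel k) (.inl R) (![1, 0] : Fin 2 → Fin (a + 1 + 1))
      Fin.elim0 (fun A e j => by revert j; exact Fin.forall_fin_two.2 ⟨rfl, rfl⟩)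
        fun _ _ j => j.elim0))))

theorem sameBase_copies (A : Str σ) (hk : 2 ≤ k) (i j : Fin k) (x y : Fin k × A.U) :
    (A.copies k hk).SameBase i j x y ↔ x.1 = i ∧ y.1 = j ∧ x.2 = y.2 := by
  constructor
  · rintro ⟨t, ⟨a, rfl⟩, rfl, rfl⟩
    exact ⟨rfl, rfl, rfl⟩
  · rintro ⟨rfl, rfl, h⟩
    exact ⟨fun i => (i, x.2), ⟨x.2, rfl⟩, rfl, Prod.ext rfl h⟩

theorem relAt_copies (A : Str (binariesVocabulary N)) (hk : 2 ≤ k) (z i j : Fin k) (R : Fin N)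
    (x y : Fin k × A.U) :
    (A.copies k hk).RelAt z i j R x y ↔ x.1 = i ∧ y.1 = j ∧ A.bin R x.2 y.2 := by
  constructor
  · rintro ⟨x', y', hx, hy, c, e, s, h, he, hs⟩
    obtain ⟨-, hx, hx'⟩ := (sameBase_copies A hk _ _ _ _).1 hx
    obtain ⟨-, hy, hy'⟩ := (sameBase_copies A hk _ _ _ _).1 hy
    refine ⟨hx, hy, ?_⟩
    have h0 : x' = (c, e (0 : Fin 2)) := congrFun he (0 : Fin 2)
    have h1 : y' = (c, e (1 : Fin 2)) := congrFun he (1 : Fin 2)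
    rw [h0] at hx'
    rw [h1] at hy'
    rw [← hx', ← hy', Str.bin]
    refine (A.rel_congr (e' := e) (s' := s) ?_ fun j => j.elim0).2 h
    exact Fin.forall_fin_two.2 ⟨rfl, rfl⟩
  · rintro ⟨hx, hy, h⟩
    refine ⟨(z, x.2), (z, y.2), (sameBase_copies A hk _ _ _ _).2 ⟨rfl, hx, rfl⟩,
      (sameBase_copies A hk _ _ _ _).2 ⟨rfl, hy, rfl⟩, z, _, _, h, ?_, ?_⟩
    · funext i
      revert i
      exact Fin.forall_fin_two.2 ⟨rfl, rfl⟩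
    · funext j
      exact j.elim0

end Copies

/-! ### Encoding several binary relations into one -/

section Gadget

variable {N : ℕ}

/-- Edges of the encoding of `N` binary relations: loops on the first copy, edges from each copy
to the next one, and edges for the `i`-th relation from copy `i + 1` to the first one. -/
def Str.GadgetEdge (A : Str ((binariesVocabulary N).addRel (N + 1))) (x y : A.U) : Prop :=
  A.SameBase 0 0 x y ∨ (∃ i : Fin N, A.SameBase i.castSucc i.succ x y) ∨
    ∃ i : Fin N, A.RelAt 0 i.succ 0 i x y

/-- The encoding of `N` binary relations, on `N + 1` copies of the universe. -/
def Str.gadget (A : Str ((binariesVocabulary N).addRel (N + 1))) : Str (binariesVocabulary 1) :=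
  A.withRel fun _ (e : Fin 2 → A.U) _ => A.GadgetEdge (e 0) (e 1)

/-- There is a path of the given length from `x` to `y` that avoids loops. -/
def Chain {U : Type} (E : U → U → Prop) : ℕ → U → U → Prop
  | 0, x, y => x = y
  | n + 1, x, y => ∃ z, Chain E n x z ∧ E z y ∧ ¬ E y y

/-- The `i`-th relation in the decoding. -/
def GadgetRel {U : Type} (E : U → U → Prop) (i : Fin N) (x y : U) : Prop :=
  ∃ z, Chain E (i + 1) x z ∧ E z y

theorem Definable.chain (l : ℕ) : ∀ {a b : ℕ} (x y : Fin a),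
    Definable fun (A : Str (binariesVocabulary 1)) (e : Fin a → A.U) (_ : Fin b → Set A.U) =>
      Chain (A.bin 0) l (e x) (e y) := by
  induction l with
  | zero => exact fun x y => .eq x y
  | succ l ih =>
    exact fun x y => .exElem (.and (ih x.succ 0) (.and (.bin 0 0 y.succ)
      (.not (.bin 0 y.succ y.succ))))

theorem isMSOTransduction_gadget (hN : 1 ≤ N) :
    IsMSOTransduction fun (A : Str (binariesVocabulary N)) B =>
      (A.copies (N + 1) (by omega)).gadget.IsIso B := by
  refine (IsMSOTransduction.copying (N + 1) (by omega)).comp_of_isIso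
    (g := fun A B => A.gadget.IsIso B) (isMSOTransduction_withRel _ fun R => ?_)
  exact .or (.sameBase 0 0 (0 : Fin 2) (1 : Fin 2)) (.or
    (.exFinite fun i => .sameBase i.castSucc i.succ (0 : Fin 2) (1 : Fin 2))
    (.exFinite fun i => .relAt 0 i.succ 0 i (0 : Fin 2) (1 : Fin 2)))

theorem isMSOTransduction_gadgetDecode :
    IsMSOTransduction fun (A : Str (binariesVocabulary 1)) (B : Str (binariesVocabulary N)) =>
      ∃ h : ∃ x, A.bin 0 x x, (A.interp (fun x => A.bin 0 x x) h fun i (e : Fin 2 → A.U) _ =>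
        GadgetRel (A.bin 0) i (e 0) (e 1)).IsIso B := by
  refine isMSOTransduction_interp (τ := binariesVocabulary N) _ _ (.bin 0 _ _) fun i => ?_
  exact .exElem (.and (.chain _ (1 : Fin 3) (0 : Fin 3)) (.bin 0 (0 : Fin 3) (2 : Fin 3)))

theorem gadgetEdge_copies (hN : 1 ≤ N) (A : Str (binariesVocabulary N))
    (x y : Fin (N + 1) × A.U) :
    (A.copies (N + 1) (by omega)).gadget.bin 0 x y ↔ (x.1 = 0 ∧ y.1 = 0 ∧ x.2 = y.2) ∨
      ((y.1 : ℕ) = x.1 + 1 ∧ x.2 = y.2) ∨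
        ∃ i : Fin N, x.1 = i.succ ∧ y.1 = 0 ∧ A.bin i x.2 y.2 := by
  refine or_congr (sameBase_copies A _ _ _ _ _) (or_congr ?_ (exists_congr fun i => ?_))
  · constructor
    · rintro ⟨i, h⟩
      obtain ⟨h1, h2, h3⟩ := (sameBase_copies A _ _ _ _ _).1 h
      refine ⟨?_, h3⟩
      exact (congrArg Fin.val h2).trans (congrArg (fun i => i.val + 1) h1).symm
    · rintro ⟨h1, h2⟩
      have := y.1.2
      exact ⟨⟨x.1, by omega⟩, (sameBase_copies A _ _ _ _ _).2 ⟨rfl, Fin.ext h1, h2⟩⟩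
  · exact relAt_copies A _ _ _ _ _ _ _

variable {U : Type} {R : Fin N → U → U → Prop} {E : Fin (N + 1) × U → Fin (N + 1) × U → Prop}

theorem gadget_loop_iff (hE : ∀ x y, E x y ↔ (x.1 = 0 ∧ y.1 = 0 ∧ x.2 = y.2) ∨
      ((y.1 : ℕ) = x.1 + 1 ∧ x.2 = y.2) ∨ ∃ i : Fin N, x.1 = i.succ ∧ y.1 = 0 ∧ R i x.2 y.2)
    (x : Fin (N + 1) × U) : E x x ↔ x.1 = 0 := by
  rw [hE]
  constructor
  · rintro (h | h | ⟨i, h, h', -⟩)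
    · exact h.1
    · omega
    · exact h'
  · exact fun h => .inl ⟨h, h, rfl⟩

/-- Loops sit exactly on the first copy, where all edges other than those from one copy to the next
end. A step to a point without a loop therefore moves to the next copy of the same element. -/
theorem gadget_chain_iff (hE : ∀ x y, E x y ↔ (x.1 = 0 ∧ y.1 = 0 ∧ x.2 = y.2) ∨
      ((y.1 : ℕ) = x.1 + 1 ∧ x.2 = y.2) ∨ ∃ i : Fin N, x.1 = i.succ ∧ y.1 = 0 ∧ R i x.2 y.2)
    (l : ℕ) (a : U) (y : Fin (N + 1) × U) : Chain E l (0, a) y ↔ (y.1 : ℕ) = l ∧ a = y.2 := by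
  induction l generalizing y with
  | zero =>
    rw [Chain, Prod.ext_iff, Fin.ext_iff, Fin.val_zero]
    exact and_congr_left' eq_comm
  | succ l ih =>
    simp only [Chain, ih, gadget_loop_iff hE]
    constructor
    · rintro ⟨z, ⟨h1, h2⟩, h3, h4⟩
      rw [hE] at h3
      simp only [h4, false_and, and_false, exists_false, or_false, false_or] at h3
      exact ⟨by omega, h2.trans h3.2⟩
    · rintro ⟨h1, h2⟩
      have := y.1.2
      refine ⟨(⟨l, by omega⟩, a), ⟨rfl, rfl⟩, (hE _ _).2 (.inr (.inl ⟨h1, h2⟩)), fun h => ?_⟩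
      rw [h] at h1
      simp at h1

theorem gadgetRel_iff (hE : ∀ x y, E x y ↔ (x.1 = 0 ∧ y.1 = 0 ∧ x.2 = y.2) ∨
      ((y.1 : ℕ) = x.1 + 1 ∧ x.2 = y.2) ∨ ∃ i : Fin N, x.1 = i.succ ∧ y.1 = 0 ∧ R i x.2 y.2)
    (i : Fin N) (a b : U) : GadgetRel E i (0, a) (0, b) ↔ R i a b := by
  simp only [GadgetRel, gadget_chain_iff hE]
  constructor
  · rintro ⟨z, ⟨h1, h2⟩, h3⟩
    rw [hE] at h3
    obtain h | h | ⟨j, h4, -, h⟩ := h3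
    · rw [h.1] at h1
      simp at h1
    · simp at h
    · have : j = i := by
        rw [h4] at h1
        exact Fin.ext (by simpa using h1)
      rwa [← this, h2]
  · intro h
    exact ⟨(i.succ, a), ⟨by simp, rfl⟩, (hE _ _).2 (.inr (.inr ⟨i, rfl, rfl, h⟩))⟩

theorem encodes_gadget (hN : 1 ≤ N) :
    Encodes (allStr (binariesVocabulary N)) (allStr (binariesVocabulary 1)) := by
  refine ⟨_, _, ⟨isMSOTransduction_gadget hN, fun _ _ _ _ => trivial⟩,
    ⟨isMSOTransduction_gadgetDecode, fun _ _ _ _ => trivial⟩, fun A _ A' => ?_⟩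
  have hE := gadgetEdge_copies hN A
  let D := (A.copies (N + 1) (by omega)).gadget
  have hloop : ∀ x : Fin (N + 1) × A.U, D.bin 0 x x ↔ x.1 = 0 :=
    gadget_loop_iff (E := D.bin 0) hE
  have hex : ∃ x, D.bin 0 x x := ⟨(0, Classical.choice A.nonempty), (hloop _).2 rfl⟩
  have key : A.IsIso (D.interp (fun x => D.bin 0 x x) hex fun i (e : Fin 2 → D.U) _ =>
      GadgetRel (D.bin 0) i (e 0) (e 1)) := by
    let f : A.U ≃ {x : Fin (N + 1) × A.U // D.bin 0 x x} :=
      { toFun := fun a => ⟨(0, a), (hloop _).2 rfl⟩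
        invFun := fun x => x.1.2
        left_inv := fun a => rfl
        right_inv := fun x => Subtype.ext (Prod.ext ((hloop _).1 x.2).symm rfl) }
    refine ⟨⟨f, fun i (e : Fin 2 → A.U) s => Iff.trans
      (A.rel_congr (e := e) (s := s) (e' := (![e 0, e 1] : Fin 2 → A.U)) (s' := Fin.elim0)
        (Fin.forall_fin_two.2 ⟨rfl, rfl⟩) fun j : Fin 0 => j.elim0)
      (gadgetRel_iff (E := D.bin 0) hE i (e 0) (e 1)).symm⟩⟩
  constructor
  · rintro ⟨B, hB, hB'⟩
    obtain ⟨h, h'⟩ := isMSOTransduction_gadgetDecode.iso_left hB' hB.symm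
    exact key.trans h'
  · intro h
    exact ⟨D, Str.IsIso.refl _, hex, key.symm.trans h⟩

end Gadget

/-! ### One binary relation -/

/-- Renaming of the relation of a structure with one binary relation. -/
def Str.toBinaries (A : Str binaryVocabulary) : Str (binariesVocabulary 1) :=
  A.withRel fun _ e _ => A.rel () e Fin.elim0

/-- Renaming of the relation of a structure with one binary relation. -/
def Str.ofBinaries (A : Str (binariesVocabulary 1)) : Str binaryVocabulary :=
  A.withRel fun _ e _ => A.rel (0 : Fin 1) e Fin.elim0

theorem isMSOTransduction_toBinaries :
    IsMSOTransduction fun A B => (Str.toBinaries A).IsIso B :=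
  isMSOTransduction_withRel _ fun _ =>
    .rel_of_eq (σ := binaryVocabulary) () id Fin.elim0 (fun _ _ _ => rfl) fun _ _ j => j.elim0

theorem isMSOTransduction_ofBinaries :
    IsMSOTransduction fun A B => (Str.ofBinaries A).IsIso B :=
  isMSOTransduction_withRel _ fun _ =>
    .rel_of_eq (σ := binariesVocabulary 1) (0 : Fin 1) id Fin.elim0 (fun _ _ _ => rfl)
      fun _ _ j => j.elim0

theorem encodes_of_inverse {σ τ : Vocabulary} {C : StrClass σ} {D : StrClass τ}
    {f : Str σ → Str τ} {g : Str τ → Str σ → Prop}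
    (hf : IsMSOTransduction fun A B => (f A).IsIso B) (hg : IsMSOTransduction g)
    (hfD : ∀ A ∈ C.carrier, f A ∈ D.carrier) (hgC : ∀ B ∈ D.carrier, ∀ A, g B A → A ∈ C.carrier)
    (hfg : ∀ A ∈ C.carrier, ∀ A', g (f A) A' ↔ A.IsIso A') : Encodes C D := by
  refine ⟨_, g, ⟨hf, fun A hA B h => D.iso_closed _ _ h (hfD A hA)⟩, ⟨hg, hgC⟩, fun A hA A' => ?_⟩
  rw [← hfg A hA]
  exact ⟨fun ⟨B, h, h'⟩ => hg.iso_left h' h.symm, fun h => ⟨_, Str.IsIso.refl _, h⟩⟩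

theorem encodingEquivalent_binaryRelations :
    EncodingEquivalent (allStr (binariesVocabulary 1)) binaryRelations := by
  constructor
  · refine encodes_of_inverse isMSOTransduction_ofBinaries isMSOTransduction_toBinaries
      (fun _ _ => trivial) (fun _ _ _ _ => trivial) fun A _ A' => ?_
    have : A.ofBinaries.toBinaries.IsIso A := by
      refine ⟨⟨Equiv.refl A.U, fun i e s => ?_⟩⟩
      obtain rfl := Subsingleton.elim (0 : Fin 1) i
      exact A.rel_congr (R := (0 : Fin 1)) (fun _ => rfl) fun j => j.elim0
    exact ⟨this.symm.trans, this.trans⟩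
  · refine encodes_of_inverse isMSOTransduction_toBinaries isMSOTransduction_ofBinaries
      (fun _ _ => trivial) (fun _ _ _ _ => trivial) fun A _ A' => ?_
    have : A.toBinaries.ofBinaries.IsIso A :=
      ⟨⟨Equiv.refl A.U, fun i e s => A.rel_congr (fun _ => rfl) fun j => j.elim0⟩⟩
    exact ⟨this.symm.trans, this.trans⟩

/-! ### Independence from the null relation -/

/-- The independence structure of a null structure. -/
def Str.indOf {k : Type*} [AddCommMonoid k] {n : ℕ} (c : Fin n → k) (A : Str (setVocabulary n)) :
    Str (setVocabulary 1) :=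
  A.withRel fun _ _ (X : Fin 1 → Set A.U) => ∀ Y : Fin n → Set A.U, A.rel () Fin.elim0 Y →
    (∀ x, x ∉ X 0 → coef c Y x = 0) → ∀ x, coef c Y x = 0

theorem isMSOTransduction_indOf {k : Type*} [AddCommMonoid k] [Finite k] {n : ℕ} (c : Fin n → k) :
    IsMSOTransduction fun A B => (Str.indOf c A).IsIso B := by
  have h : Definable fun (A : Str (setVocabulary n)) (_ : Fin 0 → A.U) (X : Fin 1 → Set A.U) =>
      ∀ Y : Fin n → Set A.U, A.rel () Fin.elim0 Y →
        (∀ x, x ∉ X 0 → coef c Y x = 0) → ∀ x, coef c Y x = 0 := by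
    have h' : Definable fun (A : Str (setVocabulary n)) (_ : Fin 0 → A.U)
        (s : Fin (1 + n) → Set A.U) => A.rel () Fin.elim0 fun i : Fin n => s (Fin.natAdd 1 i) :=
      .rel_of_eq (σ := setVocabulary n) () Fin.elim0 (Fin.natAdd 1) (fun _ _ j => j.elim0)
        fun _ _ _ => rfl
    exact .allSets (.imp h' (.imp (.allElem (.imp (.not (.mem _ _)) (DefinableFun.coef c _ _ _)))
      (.allElem (DefinableFun.coef c _ _ _))))
  exact isMSOTransduction_withRel _ fun _ => h

/-- The set `X` supports no nontrivial linear relation between the rows of the matrix `M`. -/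
def RowIndep {k U : Type*} [Semiring k] [Fintype U] (M : U → U → k) (X : Set U) : Prop :=
  ∀ l : U → k, (∀ y, ∑ x, l x * M x y = 0) → (∀ x, x ∉ X → l x = 0) → ∀ x, l x = 0

theorem indOf_matNull {k : Type*} [Field k] {N n : ℕ} (en : Fin N → k) {c : Fin n → k}
    (hc : ∀ a, ∃ I : Finset (Fin n), ∑ i ∈ I, c i = a) (A : Str (binariesVocabulary N))
    [Fintype A.U] (e : Fin 0 → A.U) (X : Fin 1 → Set A.U) :
    ((A.matNull en c).indOf c).rel () e X ↔ RowIndep (relEntry en A.bin) (X 0) := by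
  have h : ∀ Y : Fin n → Set A.U, (A.matNull en c).rel () Fin.elim0 Y ↔
      ∀ y, ∑ x, coef c Y x * relEntry en A.bin x y = 0 := fun Y =>
    forall_congr' fun y => by rw [finsum_eq_sum_of_fintype]
  constructor
  · intro H l hl hX x
    obtain ⟨Y, hY⟩ := exists_coef_eq hc l
    rw [← hY]
    exact H Y ((h Y).2 fun y => by simpa only [hY] using hl y)
      (fun x hx => (hY x).trans (hX x hx)) x
  · exact fun H Y hY hX x => H _ ((h Y).1 hY) hX x

/-- Links the relation definable from null tuples to the independence used in the class of
represented matroids. -/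
theorem rowIndep_iff {k U : Type*} [Field k] [Fintype U] (M : U → U → k) (X : Set U) :
    RowIndep M X ↔ LinearIndepOn k M X := by
  rw [linearIndepOn_iff]
  constructor
  · intro H l hlX hl
    refine Finsupp.ext fun x => H l (fun y => ?_) (fun x hx => ?_) x
    · rw [Finsupp.linearCombination_apply, Finsupp.sum_fintype _ _ (by simp)] at hl
      simpa using congrFun hl y
    · rw [Finsupp.mem_supported] at hlX
      by_contra hne
      exact hx (hlX (by simpa using hne))
  · intro H l hl hX x
    have := H (Finsupp.equivFunOnFinite.symm l) ?_ ?_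
    · simpa using DFunLike.congr_fun this x
    · rw [Finsupp.mem_supported]
      intro x hx
      by_contra hne
      simp [hX x hne] at hx
    · rw [Finsupp.linearCombination_apply, Finsupp.sum_fintype _ _ (by simp)]
      funext y
      simpa using hl y

theorem indOf_matNull_mem {F : Type*} [Field F] {N n : ℕ} (en : Fin N → F) {c : Fin n → F}
    (hc : ∀ a, ∃ I : Finset (Fin n), ∑ i ∈ I, c i = a) (A : Str (binariesVocabulary N)) :
    (A.matNull en c).indOf c ∈ (independenceMatroids F).carrier := by
  cases nonempty_fintype A.U
  refine ⟨⟨A.U, A.finite, A.nonempty, A.U → F, inferInstance, inferInstance,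
    relEntry en A.bin⟩, ⟨⟨Equiv.refl A.U, fun R e X => ?_⟩⟩⟩
  exact (rowIndep_iff _ _).symm.trans ((indOf_matNull en hc A Fin.elim0 X).symm.trans
    (Str.rel_congr _ (fun j : Fin 0 => j.elim0) fun j => (Set.image_id _).symm))

/-! ### A matroid that encodes a binary relation -/

section Encoding

/-- The types of the ten copies of an element. -/
def typ : Fin 10 → Fin 5 := ![0, 1, 1, 2, 2, 3, 3, 4, 4, 4]

/-- The incidences between types of vectors and base vectors for the same element. -/
def inc (t : Fin 5) (j : Fin 10) : Prop :=
  (j = 0 ∧ (t = 0 ∨ t = 4)) ∨ (j = 1 ∧ (t = 1 ∨ t = 3 ∨ t = 4)) ∨ (j = 2 ∧ (t = 2 ∨ t = 3))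

/-- The incidence relation between vectors and base vectors. -/
def Str.Incident (A : Str ((binariesVocabulary 1).addRel 10)) (x y : A.U) : Prop :=
  (∃ p : Fin 10 × Fin 10, inc (typ p.1) p.2 ∧ A.SameBase p.1 p.2 x y) ∨
    ∃ i : Fin 10, typ i = 3 ∧ A.RelAt 0 i 0 0 x y

/-- The zero-one matrix of the incidence relation. -/
def Str.incidence {k : Type*} [One k] {N : ℕ} (en : Fin N → k)
    (A : Str ((binariesVocabulary 1).addRel 10)) : Str (binariesVocabulary N) :=
  A.withRel fun i (e : Fin 2 → A.U) _ => en i = 1 ∧ A.Incident (e 0) (e 1)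

theorem isMSOTransduction_incidence {k : Type*} [One k] {N : ℕ} (en : Fin N → k) :
    IsMSOTransduction fun (A : Str (binariesVocabulary 1)) B =>
      ((A.copies 10 (by norm_num)).incidence en).IsIso B := by
  refine (IsMSOTransduction.copying 10 (by norm_num)).comp_of_isIso
    (g := fun A B => (A.incidence en).IsIso B) (isMSOTransduction_withRel _ fun i => ?_)
  exact .and (.const _) (.or
    (.exFinite fun p => .and (.const _) (.sameBase p.1 p.2 (0 : Fin 2) (1 : Fin 2)))
    (.exFinite fun i => .and (.const _) (.relAt 0 i 0 0 (0 : Fin 2) (1 : Fin 2))))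

/-- The incidence relation on ten copies of a set with a binary relation. -/
def Inc {U : Type} (R : U → U → Prop) (x y : Fin 10 × U) : Prop :=
  (inc (typ x.1) y.1 ∧ x.2 = y.2) ∨ (typ x.1 = 3 ∧ y.1 = 0 ∧ R x.2 y.2)

theorem incident_copies (A : Str (binariesVocabulary 1)) (x y : Fin 10 × A.U) :
    (A.copies 10 (by norm_num)).Incident x y ↔ Inc (A.bin 0) x y := by
  refine or_congr ⟨?_, ?_⟩ ⟨?_, ?_⟩
  · rintro ⟨p, h, h'⟩
    obtain ⟨h1, h2, h3⟩ := (sameBase_copies A _ _ _ _ _).1 h'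
    rw [← h1, ← h2] at h
    exact ⟨h, h3⟩
  · rintro ⟨h, h'⟩
    exact ⟨(x.1, y.1), h, (sameBase_copies A _ _ _ _ _).2 ⟨rfl, rfl, h'⟩⟩
  · rintro ⟨i, h, h'⟩
    obtain ⟨h1, h2, h3⟩ := (relAt_copies A _ _ _ _ _ _ _).1 h'
    rw [← h1] at h
    exact ⟨h, h2, h3⟩
  · rintro ⟨h, h', h''⟩
    exact ⟨x.1, h, (relAt_copies A _ _ _ _ _ _ _).2 ⟨rfl, h', h''⟩⟩

open Classical in
/-- The matrix of the incidence relation. -/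
noncomputable def incMatrix (k : Type*) [Field k] {U : Type} (R : U → U → Prop)
    (x y : Fin 10 × U) : k :=
  if Inc R x y then 1 else 0

/-- Only the relation that belongs to the scalar 1 can be nonempty, and the bijection `en` provides
it exactly once. -/
theorem relEntry_incidence {k : Type*} [Field k] {N : ℕ} (en : Fin N ≃ k)
    (A : Str (binariesVocabulary 1)) (x y : Fin 10 × A.U) :
    relEntry en ((A.copies 10 (by norm_num)).incidence en).bin x y = incMatrix k (A.bin 0) x y := by
  have hb : ∀ i, ((A.copies 10 (by norm_num)).incidence en).bin i x y ↔
      en i = 1 ∧ Inc (A.bin 0) x y := fun i => and_congr_right fun _ => incident_copies A x y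
  refine (Finset.sum_eq_single (en.symm 1) ?_ ?_).trans ?_
  · intro i _ hi
    rw [if_neg]
    exact fun h => hi (by rw [← ((hb i).1 h).1]; simp)
  · simp
  · classical exact if_congr ((hb _).trans (by simp)) (by simp) rfl

variable {k : Type*} [Field k] {U : Type} {R : U → U → Prop}

/-- The sum of the coefficients of all copies of `u` of the given type. -/
def typSum (l : Fin 10 × U → k) (t : Fin 5) (u : U) : k :=
  ∑ i, if typ i = t then l (i, u) else 0

theorem exists_of_typSum_ne_zero {l : Fin 10 × U → k} {t : Fin 5} {u : U}
    (h : typSum l t u ≠ 0) : ∃ x : Fin 10 × U, typ x.1 = t ∧ x.2 = u ∧ l x ≠ 0 := by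
  obtain ⟨i, -, hi⟩ := Finset.exists_ne_zero_of_sum_ne_zero h
  by_cases hit : typ i = t
  · rw [if_pos hit] at hi
    exact ⟨(i, u), hit, rfl, hi⟩
  · exact absurd (if_neg hit) hi

/-- If `X` contains at most one copy of each type for each element, then a type sum at a member of
`X` is a single coefficient. -/
theorem eq_zero_of_typSum_eq_zero {l : Fin 10 × U → k} (h : ∀ t u, typSum l t u = 0)
    {X : Set (Fin 10 × U)} (hX : ∀ x ∈ X, ∀ y ∈ X, typ x.1 = typ y.1 → x.2 = y.2 → x = y)
    (hl : ∀ x, x ∉ X → l x = 0) (x : Fin 10 × U) : l x = 0 := by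
  by_cases hx : x ∈ X
  · have := h (typ x.1) x.2
    rw [typSum, Finset.sum_eq_single x.1, if_pos rfl] at this
    · exact this
    · intro i _ hi
      split_ifs with hit
      · by_contra hne
        exact hi (congrArg Prod.fst
          (hX (i, x.2) (by by_contra h'; exact hne (hl _ h')) x hx hit rfl))
      · rfl
    · simp
  · exact hl x hx

open Classical in
theorem sum_mul_ite_typ [Fintype U] (l : Fin 10 × U → k) (p : Fin 5 → Prop) [DecidablePred p]
    (w : U) :
    ∑ x, l x * (if p (typ x.1) ∧ x.2 = w then 1 else 0) =
      ∑ t, if p t then typSum l t w else 0 := by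
  have h1 : ∀ i, (∑ t, if p t then (if typ i = t then l (i, w) else 0) else 0) =
      if p (typ i) then l (i, w) else 0 := fun i => by
    rw [Finset.sum_eq_single (typ i)] <;> simp +contextual [eq_comm]
  calc _ = ∑ i, if p (typ i) then l (i, w) else 0 := by
        rw [Fintype.sum_prod_type]
        refine Finset.sum_congr rfl fun i _ => ?_
        by_cases hp : p (typ i) <;> simp [hp]
    _ = _ := by
        simp only [← h1, typSum]
        rw [Finset.sum_comm]
        refine Finset.sum_congr rfl fun t _ => ?_
        by_cases hp : p t <;> simp [hp]

open Classical in
theorem sum_mul_ite_rel [Fintype U] (l : Fin 10 × U → k) (w : U) :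
    ∑ x, l x * (if typ x.1 = 3 ∧ R x.2 w then 1 else 0) =
      ∑ u, if R u w then typSum l 3 u else 0 := by
  rw [Fintype.sum_prod_type_right]
  refine Finset.sum_congr rfl fun u _ => ?_
  by_cases hR : R u w <;> simp [hR, typSum]

open Classical in
-- Copies of one type have equal rows, so only type sums enter. With a, b, c for the columns of
-- copies 0, 1, 2, the rows of types 0 to 4 for `u` are a_u, b_u, c_u, b_u + c_u + ∑ a_w over `R u
-- w`, and a_u + b_u. All other columns are zero.
theorem incMatrix_ker_iff [Fintype U] (l : Fin 10 × U → k) :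
    (∀ y, ∑ x, l x * incMatrix k R x y = 0) ↔ ∀ w,
      typSum l 0 w + typSum l 4 w + ∑ u, (if R u w then typSum l 3 u else 0) = 0 ∧
      typSum l 1 w + typSum l 3 w + typSum l 4 w = 0 ∧ typSum l 2 w + typSum l 3 w = 0 := by
  have h0 : ∀ w, ∑ x, l x * incMatrix k R x (0, w) =
      typSum l 0 w + typSum l 4 w + ∑ u, (if R u w then typSum l 3 u else 0) := by
    intro w
    have h1 := sum_mul_ite_typ l (fun t => t = 0 ∨ t = 4) w
    have h2 := sum_mul_ite_rel (R := R) l w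
    have h3 : (∑ t : Fin 5, if t = 0 ∨ t = 4 then typSum l t w else 0) =
      typSum l 0 w + typSum l 4 w := by simp [Fin.sum_univ_five]
    rw [h3] at h1
    rw [← h1, ← h2, ← Finset.sum_add_distrib]
    refine Finset.sum_congr rfl fun x _ => ?_
    rw [← mul_add]
    congr 1
    -- In column 0 the two kinds of incidence exclude each other: type 3 meets it only through `R`,
    -- types 0 and 4 only at the same element.
    by_cases h3 : typ x.1 = 3
    · simp [incMatrix, Inc, inc, h3]
    · simp [incMatrix, Inc, inc, h3]
  have h1 : ∀ w, ∑ x, l x * incMatrix k R x (1, w) =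
      typSum l 1 w + typSum l 3 w + typSum l 4 w := by
    intro w
    have h1 := sum_mul_ite_typ l (fun t => t = 1 ∨ t = 3 ∨ t = 4) w
    have h3 : (∑ t : Fin 5, if t = 1 ∨ t = 3 ∨ t = 4 then typSum l t w else 0) =
      typSum l 1 w + typSum l 3 w + typSum l 4 w := by simp [Fin.sum_univ_five]
    rw [h3] at h1
    rw [← h1]
    exact Finset.sum_congr rfl fun x _ => by simp [incMatrix, Inc, inc]
  have h2 : ∀ w, ∑ x, l x * incMatrix k R x (2, w) = typSum l 2 w + typSum l 3 w := by
    intro w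
    have h1 := sum_mul_ite_typ l (fun t => t = 2 ∨ t = 3) w
    have h3 : (∑ t : Fin 5, if t = 2 ∨ t = 3 then typSum l t w else 0) =
      typSum l 2 w + typSum l 3 w := by simp [Fin.sum_univ_five]
    rw [h3] at h1
    rw [← h1]
    exact Finset.sum_congr rfl fun x _ => by simp [incMatrix, Inc, inc]
  constructor
  · exact fun h w => ⟨(h0 w).symm.trans (h _), (h1 w).symm.trans (h _), (h2 w).symm.trans (h _)⟩
  · rintro h ⟨j, w⟩
    by_cases hj0 : j = 0
    · rw [hj0]; exact (h0 w).trans (h w).1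
    by_cases hj1 : j = 1
    · rw [hj1]; exact (h1 w).trans (h w).2.1
    by_cases hj2 : j = 2
    · rw [hj2]; exact (h2 w).trans (h w).2.2
    exact Finset.sum_eq_zero fun x _ => by simp [incMatrix, Inc, inc, hj0, hj1, hj2]

end Encoding

/-! ### Dependent sets in the matroid of a binary relation -/

section Encoding

variable {k : Type*} [Field k] {U : Type} [Fintype U] {R : U → U → Prop}

/-- The rows of types 0, 1, 2 for all elements are independent; every nontrivial relation between
type sums must involve type 3 or 4. -/
theorem typSum_of_ker {l : Fin 10 × U → k} (hl : ∀ y, ∑ x, l x * incMatrix k R x y = 0)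
    (h3 : ∀ u, typSum l 3 u = 0) (h4 : ∀ u, typSum l 4 u = 0) (t : Fin 5) (u : U) :
    typSum l t u = 0 := by
  obtain ⟨e1, e2, e3⟩ := (incMatrix_ker_iff l).1 hl u
  simp only [h3, h4, ite_self, Finset.sum_const_zero, add_zero] at e1 e2 e3
  fin_cases t
  exacts [e1, e2, e3, h3 u, h4 u]

theorem typSum_two_ne_zero {l : Fin 10 × U → k} (hl : ∀ y, ∑ x, l x * incMatrix k R x y = 0) {u : U}
    (h3 : typSum l 3 u ≠ 0) : typSum l 2 u ≠ 0 := fun h => by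
  have := ((incMatrix_ker_iff l).1 hl u).2.2
  exact h3 (by rwa [h, zero_add] at this)

theorem typSum_one_or_four_ne_zero {l : Fin 10 × U → k}
    (hl : ∀ y, ∑ x, l x * incMatrix k R x y = 0) {u : U} (h3 : typSum l 3 u ≠ 0) :
    typSum l 1 u ≠ 0 ∨ typSum l 4 u ≠ 0 := by
  by_contra! h
  have := ((incMatrix_ker_iff l).1 hl u).2.1
  rw [h.1, h.2, zero_add, add_zero] at this
  exact h3 this

theorem typSum_zero_one_ne_zero {l : Fin 10 × U → k}
    (hl : ∀ y, ∑ x, l x * incMatrix k R x y = 0) (h3 : ∀ u, typSum l 3 u = 0) {u : U}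
    (h4 : typSum l 4 u ≠ 0) : typSum l 0 u ≠ 0 ∧ typSum l 1 u ≠ 0 := by
  obtain ⟨e1, e2, -⟩ := (incMatrix_ker_iff l).1 hl u
  simp only [h3, ite_self, Finset.sum_const_zero, add_zero] at e1 e2
  exact ⟨fun h => h4 (by rwa [h, zero_add] at e1), fun h => h4 (by rwa [h, zero_add] at e2)⟩

/-- In a matroid that encodes a binary relation, the parallel elements are the copies of one
element of one type. -/
theorem not_rowIndep_pair_iff {x y : Fin 10 × U} (hxy : x ≠ y) :
    ¬ RowIndep (incMatrix k R) {x, y} ↔ typ x.1 = typ y.1 ∧ x.2 = y.2 := by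
  classical
  constructor
  · contrapose!
    intro hne l hl hX
    have hmem : ∀ z, l z ≠ 0 → z = x ∨ z = y := fun z hz => by
      by_contra h
      exact hz (hX z h)
    -- A contribution of type 3 requires one of type 2 and one of type 1 or 4: three types, but at
    -- most two elements carry coefficients.
    have h3 : ∀ u, typSum l 3 u = 0 := by
      intro u
      by_contra h3
      obtain ⟨p, hp, -, hp'⟩ := exists_of_typSum_ne_zero h3
      obtain ⟨q, hq, -, hq'⟩ := exists_of_typSum_ne_zero (typSum_two_ne_zero hl h3)
      obtain ⟨r, hr, hr'⟩ : ∃ r, (typ r.1 = 1 ∨ typ r.1 = 4) ∧ l r ≠ 0 := by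
        obtain h | h := typSum_one_or_four_ne_zero hl h3
        · obtain ⟨r, hr, -, hr'⟩ := exists_of_typSum_ne_zero h
          exact ⟨r, .inl hr, hr'⟩
        · obtain ⟨r, hr, -, hr'⟩ := exists_of_typSum_ne_zero h
          exact ⟨r, .inr hr, hr'⟩
      obtain rfl | rfl := hmem p hp' <;> obtain rfl | rfl := hmem q hq' <;>
        obtain rfl | rfl := hmem r hr' <;> simp_all
    -- Without type 3, a contribution of type 4 requires types 0 and 1, again three types.
    have h4 : ∀ u, typSum l 4 u = 0 := by
      intro u
      by_contra h4
      obtain ⟨h0, h1⟩ := typSum_zero_one_ne_zero hl h3 h4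
      obtain ⟨p, hp, -, hp'⟩ := exists_of_typSum_ne_zero h4
      obtain ⟨q, hq, -, hq'⟩ := exists_of_typSum_ne_zero h0
      obtain ⟨r, hr, -, hr'⟩ := exists_of_typSum_ne_zero h1
      obtain rfl | rfl := hmem p hp' <;> obtain rfl | rfl := hmem q hq' <;>
        obtain rfl | rfl := hmem r hr' <;> simp_all
    refine eq_zero_of_typSum_eq_zero (typSum_of_ker hl h3 h4) ?_ hX
    rintro p (rfl | rfl) q (rfl | rfl) h1 h2
    · rfl
    · exact absurd h2 (hne h1)
    · exact absurd h2.symm (hne h1.symm)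
    · rfl
  · rintro ⟨h1, h2⟩ h
    have := h (fun z => (if z = x then 1 else 0) - if z = y then 1 else 0) ?_ ?_ x
    · simp [hxy] at this
    · intro z
      have hI : Inc R x z ↔ Inc R y z := by simp only [Inc, h1, h2]
      have hM : incMatrix k R x z = incMatrix k R y z := by simp only [incMatrix, hI]
      simp [sub_mul, hM]
    · intro z hz
      have hz' : z ≠ x ∧ z ≠ y := by simpa using hz
      simp [hz'.1, hz'.2]

/-- A base element, an element of middle multiplicity and a sum can only be dependent if the middle
one is the auxiliary base vector of the same element. -/
theorem of_not_rowIndep_triple {b d z : Fin 10 × U} (hb : typ b.1 = 0)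
    (hd : typ d.1 ≠ 0 ∧ typ d.1 ≠ 4) (hz : typ z.1 = 4)
    (h : ¬ RowIndep (incMatrix k R) {b, d, z}) : typ d.1 = 1 ∧ d.2 = b.2 := by
  contrapose! h
  intro l hl hX
  have hmem : ∀ x, l x ≠ 0 → x = b ∨ x = d ∨ x = z := fun x hx => by
    by_contra h
    exact hx (hX x h)
  have hmem' : ∀ x, l x ≠ 0 → typ x.1 ≠ 0 → typ x.1 ≠ 4 → x = d := by
    intro x hx h0 h4
    obtain rfl | rfl | rfl := hmem x hx
    exacts [absurd hb h0, rfl, absurd hz h4]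
  -- Types 3 and 2 would both have to be contributed by `d`.
  have h3 : ∀ u, typSum l 3 u = 0 := by
    intro u
    by_contra h3
    obtain ⟨p, hp, -, hp'⟩ := exists_of_typSum_ne_zero h3
    obtain ⟨q, hq, -, hq'⟩ := exists_of_typSum_ne_zero (typSum_two_ne_zero hl h3)
    rw [hmem' p hp' (by simp [hp]) (by simp [hp])] at hp
    rw [hmem' q hq' (by simp [hq]) (by simp [hq]), hp] at hq
    simp at hq
  -- Type 4 at `u` requires types 0 and 1 at the same `u`; only `b` and `d` can supply these, which
  -- the assumption `h` excludes.
  have h4 : ∀ u, typSum l 4 u = 0 := by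
    intro u
    by_contra h4
    obtain ⟨h0, h1⟩ := typSum_zero_one_ne_zero hl h3 h4
    obtain ⟨q, hq, hqu, hq'⟩ := exists_of_typSum_ne_zero h0
    obtain ⟨r, hr, hru, hr'⟩ := exists_of_typSum_ne_zero h1
    have hrd := hmem' r hr' (by simp [hr]) (by simp [hr])
    have hqb : q = b := by
      obtain rfl | rfl | rfl := hmem q hq'
      exacts [rfl, absurd hq hd.1, by simp [hz] at hq]
    rw [hrd] at hr hru
    rw [hqb] at hqu
    exact h hr (hru.trans hqu.symm)
  refine eq_zero_of_typSum_eq_zero (typSum_of_ker hl h3 h4) ?_ hX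
  rintro p (rfl | rfl | rfl) q (rfl | rfl | rfl) h1 h2 <;> simp_all

open Classical in
theorem not_rowIndep_triple (u : U) :
    ¬ RowIndep (incMatrix k R) {((0 : Fin 10), u), (1, u), (7, u)} := by
  intro h
  -- The row of copy 7, of type 4, is the sum of the rows of copies 0 and 1.
  let l : Fin 10 × U → k := fun x => if x.2 = u then ![1, 1, 0, 0, 0, 0, 0, -1, 0, 0] x.1 else 0
  have := h l ((incMatrix_ker_iff l).2 fun w => ?_) (fun x hx => ?_) (0, u)
  · simp [l] at this
  · by_cases hw : w = u <;> simp [typSum, l, Fin.sum_univ_succ, typ, hw]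
  · obtain ⟨i, w⟩ := x
    by_cases hw : w = u
    · subst hw
      have : i ≠ 0 ∧ i ≠ 1 ∧ i ≠ 7 := by simpa using hx
      fin_cases i <;> simp_all [l]
    · simp [l, hw]

/-- If `w` is indispensable for the dependence of the base elements together with `x`, `y` and
the auxiliary base vector `d`, then the element of `d` is related to the element of `w`. -/
theorem rel_of_rowIndep {x y d w : Fin 10 × U} (hx : typ x.1 ≠ 0 ∧ typ x.1 ≠ 4)
    (hy : typ y.1 ≠ 0 ∧ typ y.1 ≠ 4) (hd : typ d.1 = 1) (hw : typ w.1 = 0)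
    (h : ¬ RowIndep (incMatrix k R) ({x, y, d} ∪ {b | typ b.1 = 0}))
    (h' : RowIndep (incMatrix k R) ({x, y, d} ∪ {b | typ b.1 = 0 ∧ b ≠ w})) : R d.2 w.2 := by
  classical
  simp only [RowIndep, not_forall] at h
  obtain ⟨l, hl, hX, z, hz⟩ := h
  -- A relation that avoids `w` would contradict the independence that holds after removing `w`.
  have hlw : l w ≠ 0 := by
    intro hlw
    refine hz (h' l hl (fun p hp => ?_) z)
    by_cases hpw : p = w
    · rw [hpw, hlw]
    · refine hX p fun h => hp ?_
      obtain h | h := h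
      · exact .inl h
      · exact .inr ⟨h, hpw⟩
  have hmem : ∀ p, l p ≠ 0 → typ p.1 ≠ 0 → p = x ∨ p = y ∨ p = d := fun p hp h0 => by
    by_contra h
    refine hp (hX p ?_)
    rintro (h1 | h1)
    exacts [h h1, h0 h1]
  have h4 : ∀ u, typSum l 4 u = 0 := by
    intro u
    by_contra h4
    obtain ⟨p, hp, -, hp'⟩ := exists_of_typSum_ne_zero h4
    obtain rfl | rfl | rfl := hmem p hp' (by simp [hp])
    exacts [hx.2 hp, hy.2 hp, by simp [hd] at hp]
  have h0 : typSum l 0 w.2 = l w := by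
    have : ∀ i, typ i = 0 → i = 0 := by decide
    rw [typSum, Finset.sum_eq_single 0]
    · rw [← this _ hw]
      simp [hw]
    · intro i _ hi
      rw [if_neg fun h => hi (this i h)]
    · simp
  -- In column `(0, w.2)` the nonzero coefficient of `w` can only be cancelled by rows of type 3
  -- whose elements are related to `w.2`.
  have hsum : ∑ u, (if R u w.2 then typSum l 3 u else 0) ≠ 0 := fun hs => by
    have := ((incMatrix_ker_iff l).1 hl w.2).1
    rw [h0, h4, hs] at this
    exact hlw (by simpa using this)
  obtain ⟨u, -, hu⟩ := Finset.exists_ne_zero_of_sum_ne_zero hsum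
  by_cases hR : R u w.2
  · rw [if_pos hR] at hu
    obtain ⟨p, hp, -, hp'⟩ := exists_of_typSum_ne_zero hu
    obtain ⟨q, hq, -, hq'⟩ := exists_of_typSum_ne_zero (typSum_two_ne_zero hl hu)
    obtain ⟨r, hr, hru, hr'⟩ := exists_of_typSum_ne_zero
      ((typSum_one_or_four_ne_zero hl hu).resolve_right fun h => h (h4 u))
    -- As `d` has type 1, the contributors of types 3 and 2 are `x` and `y` in some order. Only `d`
    -- remains to contribute type 1, so the related element is that of `d`.
    have hrd : r = d := by
      have hp1 := hmem p hp' (by simp [hp])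
      have hq1 := hmem q hq' (by simp [hq])
      obtain rfl | rfl | rfl := hmem r hr' (by simp [hr])
      · obtain rfl | rfl | rfl := hp1 <;> obtain rfl | rfl | rfl := hq1 <;> simp_all
      · obtain rfl | rfl | rfl := hp1 <;> obtain rfl | rfl | rfl := hq1 <;> simp_all
      · rfl
    rwa [← hrd, hru]
  · exact absurd (if_neg hR) hu

open Classical in
theorem not_rowIndep_union (u : U) : ¬ RowIndep (incMatrix k R)
    ({((5 : Fin 10), u), (3, u), (1, u)} ∪ {b | typ b.1 = 0}) := by
  intro h
  -- The row of copy 5 minus those of copies 3 and 1 leaves the sum of the base rows of all elements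
  -- related to `u`; subtracting these gives zero.
  let l : Fin 10 × U → k := fun x =>
    ![if R u x.2 then -1 else 0, if x.2 = u then -1 else 0, 0, if x.2 = u then -1 else 0, 0,
      if x.2 = u then 1 else 0, 0, 0, 0, 0] x.1
  have := h l ((incMatrix_ker_iff l).2 fun w => ?_) (fun x hx => ?_) (5, u)
  · simp [l] at this
  · refine ⟨?_, ?_, ?_⟩
    · have h3 : ∀ v, typSum l 3 v = if v = u then 1 else 0 := fun v => by
        simp [typSum, l, Fin.sum_univ_succ, typ]
      rw [Finset.sum_eq_single u (fun v _ hv => by simp [h3, hv]) (by simp), h3]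
      by_cases hw : R u w <;> simp [typSum, l, Fin.sum_univ_succ, typ, hw]
    · by_cases hw : w = u <;> simp [typSum, l, Fin.sum_univ_succ, typ, hw]
    · by_cases hw : w = u <;> simp [typSum, l, Fin.sum_univ_succ, typ, hw]
  · obtain ⟨i, w⟩ := x
    fin_cases i <;> simp_all [l, typ]

/-- With `(0, w)` removed, the only remaining row that meets column `(0, w)` is the one of type 3,
because `R u w`. Its coefficient vanishes, and the other rows are independent. -/
theorem rowIndep_of_rel {u w : U} (hR : R u w) : RowIndep (incMatrix k R)
    ({((5 : Fin 10), u), (3, u), (1, u)} ∪ {b | typ b.1 = 0 ∧ b ≠ (0, w)}) := by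
  classical
  intro l hl hX
  have h00 : ∀ i, typ i = 0 → i = 0 := by decide
  have h4 : ∀ v, typSum l 4 v = 0 := by
    intro v
    by_contra h4
    obtain ⟨p, hp, -, hp'⟩ := exists_of_typSum_ne_zero h4
    refine hp' (hX p ?_)
    rintro ((rfl | rfl | rfl) | h)
    · simp [typ] at hp
    · simp [typ] at hp
    · simp [typ] at hp
    · rw [h.1] at hp
      simp at hp
  have h3' : ∀ v, v ≠ u → typSum l 3 v = 0 := by
    intro v hv
    by_contra h3
    obtain ⟨p, hp, hpv, hp'⟩ := exists_of_typSum_ne_zero h3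
    refine hp' (hX p ?_)
    rintro ((rfl | rfl | rfl) | h)
    · exact hv hpv.symm
    · exact hv hpv.symm
    · exact hv hpv.symm
    · rw [h.1] at hp
      simp at hp
  have h0 : typSum l 0 w = 0 := by
    by_contra h0
    obtain ⟨p, hp, hpv, hp'⟩ := exists_of_typSum_ne_zero h0
    refine hp' (hX p ?_)
    rintro ((rfl | rfl | rfl) | h)
    · simp [typ] at hp
    · simp [typ] at hp
    · simp [typ] at hp
    · exact h.2 (Prod.ext (h00 _ hp) hpv)
  have h3 : ∀ v, typSum l 3 v = 0 := by
    intro v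
    by_cases hv : v = u
    · have := ((incMatrix_ker_iff l).1 hl w).1
      rw [h0, h4, Finset.sum_eq_single u (fun v _ hv => by rw [h3' v hv, ite_self]) (by simp),
        if_pos hR] at this
      rw [hv]
      simpa using this
    · exact h3' v hv
  refine eq_zero_of_typSum_eq_zero (typSum_of_ker hl h3 h4) ?_ hX
  rintro p ((rfl | rfl | rfl) | hp) q ((rfl | rfl | rfl) | hq) h1 h2
  all_goals first
    | rfl
    | (simp [typ] at h1; done)
    | (rw [hq.1] at h1; simp [typ] at h1; done)
    | (rw [hp.1] at h1; simp [typ] at h1; done)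
    | exact Prod.ext ((h00 _ hp.1).trans (h00 _ hq.1).symm) h2

end Encoding

/-! ### Decoding a binary relation from independence -/

section Decode

/-- Distinct and not independent. -/
def Par {U : Type} (I : Set U → Prop) (x y : U) : Prop := x ≠ y ∧ ¬ I {x, y}

/-- There are at least two elements parallel to `x`, including `x`. -/
def Two {U : Type} (I : Set U → Prop) (x : U) : Prop := ∃ y, Par I x y

/-- There are at least three elements parallel to `x`, including `x`. -/
def Three {U : Type} (I : Set U → Prop) (x : U) : Prop := ∃ y z, y ≠ z ∧ Par I x y ∧ Par I x z

/-- The parallel class of `x` has exactly two elements. -/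
def Mid {U : Type} (I : Set U → Prop) (x : U) : Prop := Two I x ∧ ¬ Three I x

/-- The binary relation decoded from independence. -/
def DecRel {U : Type} (I : Set U → Prop) (u w : U) : Prop :=
  ∃ d z x y, Mid I d ∧ Mid I x ∧ Mid I y ∧ Three I z ∧ ¬ I {u, d, z} ∧
    ¬ I ({x, y, d} ∪ {b | ¬ Two I b}) ∧ I ({x, y, d} ∪ {b | ¬ Two I b ∧ b ≠ w})

/-- The independent sets. -/
def Str.ind (A : Str (setVocabulary 1)) (X : Set A.U) : Prop := A.rel () Fin.elim0 fun _ => X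

theorem Definable.ind {n m : ℕ}
    {S : ∀ A : Str (setVocabulary 1), (Fin n → A.U) → (Fin m → Set A.U) → Set A.U}
    (hS : Definable fun (A : Str (setVocabulary 1)) (e : Fin (n + 1) → A.U) s =>
      e 0 ∈ S A (fun i => e i.succ) s) :
    Definable fun (A : Str (setVocabulary 1)) e s => A.ind (S A e s) :=
  substSet (Q := fun A X _ _ => A.ind X)
    (.rel_of_eq (σ := setVocabulary 1) () Fin.elim0 (fun _ => 0) (fun _ _ j => j.elim0)
      fun _ _ _ => rfl) hS

theorem Definable.par {n m : ℕ} (x y : Fin n) :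
    Definable fun (A : Str (setVocabulary 1)) (e : Fin n → A.U) (_ : Fin m → Set A.U) =>
      Par A.ind (e x) (e y) :=
  .and (.not (.eq _ _)) (.not (.ind (S := fun _ e _ => {e x, e y})
    ((Definable.or (.eq 0 x.succ) (.eq 0 y.succ)).congr fun _ _ _ => Iff.rfl)))

theorem Definable.two {n m : ℕ} (x : Fin n) :
    Definable fun (A : Str (setVocabulary 1)) (e : Fin n → A.U) (_ : Fin m → Set A.U) =>
      Two A.ind (e x) :=
  .exElem (.par x.succ 0)

theorem Definable.three {n m : ℕ} (x : Fin n) :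
    Definable fun (A : Str (setVocabulary 1)) (e : Fin n → A.U) (_ : Fin m → Set A.U) =>
      Three A.ind (e x) :=
  .exElem (.exElem (.and (.not (.eq 1 0)) (.and (.par x.succ.succ 1) (.par x.succ.succ 0))))

theorem Definable.mid {n m : ℕ} (x : Fin n) :
    Definable fun (A : Str (setVocabulary 1)) (e : Fin n → A.U) (_ : Fin m → Set A.U) =>
      Mid A.ind (e x) :=
  .and (.two x) (.not (.three x))

theorem Definable.decRel :
    Definable fun (A : Str (setVocabulary 1)) (e : Fin 2 → A.U) (_ : Fin 0 → Set A.U) =>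
      DecRel A.ind (e 0) (e 1) := by
  -- Under the four quantifiers the variables 0, …, 5 are `y`, `x`, `z`, `d`, `u`, `w` of `DecRel`.
  -- In a set description all are shifted by one and variable 0 is the tested element.
  have h1 : Definable fun (A : Str (setVocabulary 1)) (e : Fin 6 → A.U) (_ : Fin 0 → Set A.U) =>
      A.ind {e 4, e 3, e 2} :=
    .ind (S := fun _ e _ => {e 4, e 3, e 2})
      ((Definable.or (.eq 0 5) (.or (.eq 0 4) (.eq 0 3))).congr fun _ _ _ => Iff.rfl)
  have h2 : Definable fun (A : Str (setVocabulary 1)) (e : Fin 6 → A.U) (_ : Fin 0 → Set A.U) =>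
      A.ind ({e 1, e 0, e 3} ∪ {b | ¬ Two A.ind b}) :=
    .ind (S := fun A e _ => {e 1, e 0, e 3} ∪ {b | ¬ Two A.ind b})
      ((Definable.or (.or (.eq 0 2) (.or (.eq 0 1) (.eq 0 4))) (.not (.two 0))).congr
        fun _ _ _ => Iff.rfl)
  have h3 : Definable fun (A : Str (setVocabulary 1)) (e : Fin 6 → A.U) (_ : Fin 0 → Set A.U) =>
      A.ind ({e 1, e 0, e 3} ∪ {b | ¬ Two A.ind b ∧ b ≠ e 5}) :=
    .ind (S := fun A e _ => {e 1, e 0, e 3} ∪ {b | ¬ Two A.ind b ∧ b ≠ e 5})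
      ((Definable.or (.or (.eq 0 2) (.or (.eq 0 1) (.eq 0 4)))
        (.and (.not (.two 0)) (.not (.eq 0 6)))).congr fun _ _ _ => Iff.rfl)
  exact .exElem (.exElem (.exElem (.exElem (.and (.mid 3) (.and (.mid 1) (.and (.mid 0)
    (.and (.three 2) (.and (.not h1) (.and (.not h2) h3)))))))))

theorem isMSOTransduction_matroidDecode :
    IsMSOTransduction fun (A : Str (setVocabulary 1)) (B : Str (binariesVocabulary 1)) =>
      ∃ h : ∃ x, ¬ Two A.ind x, (A.interp (fun x => ¬ Two A.ind x) h fun _ (e : Fin 2 → A.U) _ =>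
        DecRel A.ind (e 0) (e 1)).IsIso B :=
  isMSOTransduction_interp (τ := binariesVocabulary 1) _ _ (.not (.two 0)) fun _ => .decRel

variable {k : Type*} [Field k] {U : Type} [Fintype U] {R : U → U → Prop}

theorem par_incMatrix_iff (x y : Fin 10 × U) :
    Par (RowIndep (incMatrix k R)) x y ↔ x.1 ≠ y.1 ∧ typ x.1 = typ y.1 ∧ x.2 = y.2 := by
  constructor
  · rintro ⟨h, h'⟩
    obtain ⟨h1, h2⟩ := (not_rowIndep_pair_iff h).1 h'
    exact ⟨fun h3 => h (Prod.ext h3 h2), h1, h2⟩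
  · rintro ⟨h, h1, h2⟩
    have hxy : x ≠ y := fun h3 => h (congrArg _ h3)
    exact ⟨hxy, (not_rowIndep_pair_iff hxy).2 ⟨h1, h2⟩⟩

theorem two_incMatrix_iff (x : Fin 10 × U) :
    Two (RowIndep (incMatrix k R)) x ↔ typ x.1 ≠ 0 := by
  -- Type 0 is the only type with a single copy.
  have key : ∀ i, (∃ j, i ≠ j ∧ typ i = typ j) ↔ typ i ≠ 0 := by decide
  rw [← key]
  simp only [Two, par_incMatrix_iff]
  exact ⟨fun ⟨y, h, h', _⟩ => ⟨_, h, h'⟩, fun ⟨j, h, h'⟩ => ⟨(j, x.2), h, h', rfl⟩⟩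

theorem three_incMatrix_iff (x : Fin 10 × U) :
    Three (RowIndep (incMatrix k R)) x ↔ typ x.1 = 4 := by
  -- Type 4 is the only type with three copies.
  have key : ∀ i, (∃ j j', j ≠ j' ∧ (i ≠ j ∧ typ i = typ j) ∧ (i ≠ j' ∧ typ i = typ j')) ↔
      typ i = 4 := by decide
  rw [← key]
  simp only [Three, par_incMatrix_iff]
  constructor
  · rintro ⟨y, z, hyz, ⟨h1, h2, h3⟩, ⟨h4, h5, h6⟩⟩
    exact ⟨_, _, fun h => hyz (Prod.ext h (h3.symm.trans h6)), ⟨h1, h2⟩, ⟨h4, h5⟩⟩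
  · rintro ⟨j, j', h, ⟨h1, h2⟩, ⟨h3, h4⟩⟩
    exact ⟨(j, x.2), (j', x.2), fun h' => h (congrArg Prod.fst h'), ⟨h1, h2, rfl⟩, ⟨h3, h4, rfl⟩⟩

theorem mid_incMatrix_iff (x : Fin 10 × U) :
    Mid (RowIndep (incMatrix k R)) x ↔ typ x.1 ≠ 0 ∧ typ x.1 ≠ 4 := by
  rw [Mid, two_incMatrix_iff, three_incMatrix_iff]

theorem decRel_incMatrix_iff (u w : U) :
    DecRel (RowIndep (incMatrix k R)) (0, u) (0, w) ↔ R u w := by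
  simp only [DecRel, two_incMatrix_iff, three_incMatrix_iff, mid_incMatrix_iff, not_not]
  constructor
  · rintro ⟨d, z, x, y, hd, hx, hy, hz, h1, h2, h3⟩
    obtain ⟨hd', hu⟩ := of_not_rowIndep_triple (by rfl) hd hz h1
    have := rel_of_rowIndep hx hy hd' (by rfl) h2 h3
    rwa [hu] at this
  · intro h
    -- In the order `d`, `z`, `x`, `y`, these have types 1, 4, 3 and 2.
    exact ⟨(1, u), (7, u), (5, u), (3, u), by simp [typ], by simp [typ], by simp [typ],
      by simp [typ], not_rowIndep_triple u, not_rowIndep_union u, rowIndep_of_rel h⟩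

theorem matroidDecode_iff {k : Type*} [Field k] {N n : ℕ} (en : Fin N ≃ k) {c : Fin n → k}
    (hc : ∀ a, ∃ I : Finset (Fin n), ∑ i ∈ I, c i = a) (A A' : Str (binariesVocabulary 1))
    {D : Str (setVocabulary 1)}
    (hD : D = (((A.copies 10 (by norm_num)).incidence en).matNull en c).indOf c) :
    (∃ h : ∃ x, ¬ Two D.ind x, (D.interp (fun x => ¬ Two D.ind x) h fun _ (e : Fin 2 → D.U) _ =>
        DecRel D.ind (e 0) (e 1)).IsIso A') ↔ A.IsIso A' := by
  subst hD
  cases nonempty_fintype A.U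
  let D := (((A.copies 10 (by norm_num)).incidence en).matNull en c).indOf c
  have hI : ∀ X : Set (Fin 10 × A.U), D.ind X ↔ RowIndep (incMatrix k (A.bin 0)) X := by
    intro X
    have : relEntry en ((A.copies 10 (by norm_num)).incidence en).bin =
        incMatrix k (A.bin 0) := by
      funext x y
      exact relEntry_incidence en A x y
    let _ : Fintype ((A.copies 10 (by norm_num)).incidence (N := N) en).U :=
      inferInstanceAs (Fintype (Fin 10 × A.U))
    refine (indOf_matNull en hc ((A.copies 10 _).incidence en) Fin.elim0
      fun _ => X).trans ?_
    rw [this]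
    rfl
  have hI' : D.ind = RowIndep (incMatrix k (A.bin 0)) := funext fun X => propext (hI X)
  have htwo : ∀ x : Fin 10 × A.U, ¬ Two D.ind x ↔ x.1 = 0 := by
    intro x
    rw [hI']
    refine (not_congr (two_incMatrix_iff x)).trans ?_
    have : ∀ i, ¬ typ i ≠ 0 ↔ i = 0 := by decide
    exact this _
  have hex : ∃ x, ¬ Two D.ind x := ⟨(0, Classical.choice A.nonempty), (htwo _).2 rfl⟩
  have key : A.IsIso (D.interp (fun x => ¬ Two D.ind x) hex fun _ (e : Fin 2 → D.U) _ =>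
      DecRel D.ind (e 0) (e 1)) := by
    let f : A.U ≃ {x : Fin 10 × A.U // ¬ Two D.ind x} :=
      { toFun := fun a => ⟨(0, a), (htwo _).2 rfl⟩
        invFun := fun x => x.1.2
        left_inv := fun a => rfl
        right_inv := fun x => Subtype.ext (Prod.ext ((htwo _).1 x.2).symm rfl) }
    refine ⟨⟨f, fun i (e : Fin 2 → A.U) s => ?_⟩⟩
    obtain rfl := Subsingleton.elim (0 : Fin 1) i
    refine Iff.trans (A.rel_congr (e := e) (s := s) (e' := (![e 0, e 1] : Fin 2 → A.U))
      (s' := Fin.elim0) (Fin.forall_fin_two.2 ⟨rfl, rfl⟩) fun j : Fin 0 => j.elim0) ?_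
    refine (decRel_incMatrix_iff (k := k) (R := A.bin 0) (e 0) (e 1)).symm.trans ?_
    rw [← hI']
    rfl
  exact ⟨fun ⟨_, h⟩ => key.trans h, fun h => ⟨hex, key.symm.trans h⟩⟩

end Decode

/-! ### Encodings between the classes -/

/-- The decoding first forgets the null relation in favour of independence, so the decoding from
independence structures is reused. -/
theorem encodes_null {k : Type*} [Field k] [Finite k] {N n : ℕ} (en : Fin N ≃ k) {c : Fin n → k}
    (hc : ∀ a, ∃ I : Finset (Fin n), ∑ i ∈ I, c i = a) {C : StrClass (setVocabulary n)}
    (hC : ∀ A, Str.matNull en c A ∈ C.carrier) : Encodes (allStr (binariesVocabulary 1)) C :=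
  encodes_of_inverse
    ((isMSOTransduction_incidence en).comp_of_isIso (isMSOTransduction_matNull en c))
    ((isMSOTransduction_indOf c).comp_of_isIso isMSOTransduction_matroidDecode)
    (fun _ _ => hC _) (fun _ _ _ _ => trivial) fun A _ A' => matroidDecode_iff en hc A A' rfl

theorem encodes_independenceMatroids (F : Type*) [Field F] [Finite F] :
    Encodes (allStr (binariesVocabulary 1)) (independenceMatroids F) := by
  obtain ⟨N, ⟨e⟩⟩ := Finite.exists_equiv_fin F
  -- The null structure is only an intermediate step here, so its coefficients are free to choose.
  -- They run through all of `F`, zero included, and singletons suffice.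
  have hc : ∀ a, ∃ I : Finset (Fin N), ∑ i ∈ I, e.symm i = a := fun a => ⟨{e a}, by simp⟩
  exact encodes_of_inverse
    (((isMSOTransduction_incidence e.symm).comp_of_isIso
      (isMSOTransduction_matNull e.symm e.symm)).comp_of_isIso (isMSOTransduction_indOf e.symm))
    isMSOTransduction_matroidDecode (fun _ _ => indOf_matNull_mem _ hc _)
    (fun _ _ _ _ => trivial) fun A _ A' => matroidDecode_iff e.symm hc A A' rfl

/-- The field `k` governs the null relation and may differ from `F`, which governs only
independence: once the matroid is turned into a binary relation, the field no longer matters. -/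
theorem encodes_of_isNullRel {k F : Type*} [Field k] [Finite k] [Field F] [Finite F] {n : ℕ}
    {c : Fin n → k} (hc : ∀ a, ∃ I : Finset (Fin n), ∑ i ∈ I, c i = a)
    {C : StrClass (setVocabulary n)} (hC : ∀ A ∈ C.carrier, ∃ (W : Type*) (_ : AddCommGroup W)
      (_ : Module k W) (v : A.U → W), IsNullRel c A v)
    (hC' : ∀ (A : Str (setVocabulary n)) (v : A.U → A.U → k), IsNullRel c A v → A ∈ C.carrier) :
    EncodingEquivalent C binaryRelations ∧ Encodes C (independenceMatroids F) := by
  obtain ⟨N, ⟨e⟩⟩ := Finite.exists_equiv_fin k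
  have hN : 1 ≤ N := Nat.one_le_iff_ne_zero.2 fun h => by
    subst h
    exact (e 0).elim0
  have hmem : ∀ A, Str.matNull e.symm c A ∈ C.carrier := fun A => by
    refine hC' _ (relEntry e.symm A.bin) fun _ X => ?_
    cases nonempty_fintype A.U
    have h : ∀ l : A.U → k, (∀ y, ∑ᶠ x, l x * relEntry e.symm A.bin x y = 0) ↔
        ∑ᶠ x, l x • relEntry e.symm A.bin x = 0 := fun l => by
      simp only [finsum_eq_sum_of_fintype, funext_iff]
      simp
    exact h (coef (U := A.U) c X)
  have h1 := (encodes_binaries e.symm hc hC hmem).trans (encodes_gadget hN)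
  exact ⟨⟨h1.trans encodingEquivalent_binaryRelations.1,
    encodingEquivalent_binaryRelations.2.trans (encodes_null e.symm hc hmem)⟩,
    h1.trans (encodes_independenceMatroids F)⟩

/-! ### Matroids under null representation -/

theorem sum_smul_finsum_mem {k W : Type*} [Field k] [AddCommGroup W] [Module k W] {U : Type}
    [Finite U] {n : ℕ} (c : Fin n → k) (v : U → W) (X : Fin n → Set U) :
    ∑ i, c i • ∑ᶠ x ∈ X i, v x = ∑ᶠ x, coef c X x • v x := by
  classical
  cases nonempty_fintype U
  simp only [finsum_eq_sum_of_fintype, coef, Finset.sum_smul]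
  rw [Finset.sum_comm]
  refine Finset.sum_congr rfl fun i _ => ?_
  rw [Finset.smul_sum]
  refine Finset.sum_congr rfl fun x _ => ?_
  by_cases hx : x ∈ X i <;> simp [hx]

theorem mem_nullMatroids_iff.{u} {F : Type u} [Field F] (c : Fin (Nat.card F - 1) → F)
    (A : Str (setVocabulary (Nat.card F - 1))) :
    A ∈ (nullMatroids F c).carrier ↔ ∃ (V : Type u) (_ : AddCommGroup V) (_ : Module F V)
      (v : A.U → V), ∀ (e : Fin 0 → A.U) (X : Fin (Nat.card F - 1) → Set A.U),
        A.rel () e X ↔ ∑ i, c i • ∑ᶠ x ∈ X i, v x = 0 := by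
  constructor
  · rintro ⟨M, ⟨f⟩⟩
    refine ⟨M.V, inferInstance, inferInstance, fun x => M.vec (f.toEquiv.symm x), fun e X => ?_⟩
    have h := f.map_rel () (fun i => f.toEquiv.symm (e i)) (fun j => f.toEquiv.symm '' X j)
    refine Iff.trans (A.rel_congr (fun i : Fin 0 => i.elim0) fun j => ?_) (h.symm.trans ?_)
    · exact (f.toEquiv.image_symm_image (X j)).symm
    · have hX : ∀ Y : Set A.U, ∑ᶠ x ∈ f.toEquiv.symm '' Y, M.vec x =
          ∑ᶠ x ∈ Y, M.vec (f.toEquiv.symm x) := fun Y =>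
        finsum_mem_image f.toEquiv.symm.injective.injOn
      exact iff_of_eq (congrArg (· = 0) (Finset.sum_congr rfl fun i _ => congrArg _ (hX (X i))))
  · rintro ⟨V, _, _, v, h⟩
    refine ⟨⟨A.U, A.finite, A.nonempty, V, inferInstance, inferInstance, v⟩,
      ⟨⟨Equiv.refl A.U, fun R e X => ?_⟩⟩⟩
    exact (h e X).symm.trans (A.rel_congr (fun _ => rfl) fun j => (Set.image_id _).symm)

/-- With unit coefficients only the additive structure is visible, so vector spaces over `F` may be
viewed over the prime field. Every residue modulo p is a sum of at most p − 1 ones, and p − 1 ≤ |F|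
− 1. -/
theorem encodes_nullMatroids_one (F : Type*) [Field F] [Finite F] :
    EncodingEquivalent (nullMatroids F fun _ => 1) binaryRelations ∧
      Encodes (nullMatroids F fun _ => 1) (independenceMatroids F) := by
  obtain ⟨p, hp⟩ := CharP.exists F
  have : Fact p.Prime := ⟨CharP.char_is_prime F p⟩
  algebraize [ZMod.castHom (dvd_refl p) F]
  have hinj : Function.Injective (algebraMap (ZMod p) F) := (algebraMap (ZMod p) F).injective
  have hcard : p ≤ Nat.card F := by
    simpa using Nat.card_le_card_of_injective _ hinj
  refine encodes_of_isNullRel (k := ZMod p) (c := fun _ => 1) (fun a => ?_) (fun A hA => ?_)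
    fun A v hv => ?_
  · have ha := ZMod.val_lt a
    obtain ⟨I, -, hI⟩ := Finset.exists_subset_card_eq
      (s := (Finset.univ : Finset (Fin (Nat.card F - 1)))) (n := a.val) (by simp; omega)
    exact ⟨I, by simp [hI]⟩
  · obtain ⟨V, _, _, v, h⟩ := (mem_nullMatroids_iff _ A).1 hA
    let _ : Module (ZMod p) V := Module.compHom V (algebraMap (ZMod p) F)
    refine ⟨V, inferInstance, inferInstance, v, fun e X => ?_⟩
    rw [h, ← sum_smul_finsum_mem]
    simp only [one_smul]
  -- The inclusion of the prime field, applied to each coordinate, is additive and injective, so it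
  -- turns vectors over the prime field into vectors over `F` with the same vanishing sums.
  · let φ : (A.U → ZMod p) →+ (A.U → F) := (algebraMap (ZMod p) F).toAddMonoidHom.compLeft A.U
    have hφ : Function.Injective φ := fun f g h => funext fun x => hinj (congrFun h x)
    refine (mem_nullMatroids_iff _ A).2 ⟨A.U → F, inferInstance, inferInstance,
      fun x => φ (v x), fun e X => ?_⟩
    rw [hv, ← sum_smul_finsum_mem]
    simp only [one_smul]
    rw [← map_eq_zero_iff φ hφ, map_sum]
    simp only [φ.map_finsum_mem _ (Set.toFinite _)]

theorem encodes_nullMatroids (F : Type*) [Field F] [Finite F] {c : Fin (Nat.card F - 1) → F}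
    (hc : Function.Injective c) (hc0 : ∀ i, c i ≠ 0) :
    EncodingEquivalent (nullMatroids F c) binaryRelations ∧
      Encodes (nullMatroids F c) (independenceMatroids F) := by
  -- There are |F| − 1 units, so an injective family of |F| − 1 nonzero elements reaches all of
  -- them.
  have hsurj : Function.Surjective fun i => Units.mk0 (c i) (hc0 i) :=
    ((Nat.bijective_iff_injective_and_card _).2
      ⟨fun i j h => hc (congrArg Units.val h), by simp [Nat.card_units]⟩).2
  refine encodes_of_isNullRel (k := F) (c := c) (fun a => ?_) (fun A hA => ?_) fun A v hv => ?_
  · by_cases ha : a = 0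
    · exact ⟨∅, by simp [ha]⟩
    · obtain ⟨i, hi⟩ := hsurj (Units.mk0 a ha)
      exact ⟨{i}, by simpa using congrArg Units.val hi⟩
  · obtain ⟨V, _, _, v, h⟩ := (mem_nullMatroids_iff c A).1 hA
    refine ⟨V, inferInstance, inferInstance, v, fun e X => ?_⟩
    rw [h, sum_smul_finsum_mem]
  · refine (mem_nullMatroids_iff c A).2 ⟨A.U → F, inferInstance, inferInstance, v, fun e X => ?_⟩
    rw [hv, sum_smul_finsum_mem]

end MSO

theorem mainTheorem5 (F : Type*) [Field F] [Finite F] :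
    -- all coefficients equal to `1`
    (MSO.EncodingEquivalent (MSO.nullMatroids F fun _ => 1) MSO.binaryRelations ∧
      MSO.Encodes (MSO.nullMatroids F fun _ => 1) (MSO.independenceMatroids F)) ∧
    -- the coefficients enumerate the nonzero elements of `F`
    (∀ c : Fin (Nat.card F - 1) → F, Function.Injective c → (∀ i, c i ≠ 0) →
      MSO.EncodingEquivalent (MSO.nullMatroids F c) MSO.binaryRelations ∧
        MSO.Encodes (MSO.nullMatroids F c) (MSO.independenceMatroids F)) :=
  ⟨MSO.encodes_nullMatroids_one F, fun _ hc hc0 => MSO.encodes_nullMatroids F hc hc0⟩
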